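/- Let $(\Omega,\mathcal F,P)$ be a probability space, write $L^p=L^p(P)$, let $L^0(P)$ be the space of real random variables modulo $P$-a.s. equality, and let $\varphi_0:L^\infty\to\mathbb R$ be a finite convex function, increasing for the $P$-a.s. order, with $\varphi_0(0)=0$, not identically $0$, and with the Lebesgue property: $\sup_n\|X_n\|_\infty<\infty$ and $X_n\to X$ $P$-a.s. imply $\varphi_0(X_n)\to\varphi_0(X)$. Put $$\varphi_0^*(Z)=\sup_{X\in L^\infty}\big(E[XZ]-\varphi_0(X)\big)\quad(Z\in L^1),\qquad \operatorname{dom}\varphi_0^*=\{Z\in L^1:\varphi_0^*(Z)<\infty\},$$ $$\hat\varphi(X)=\sup_{Z\in\operatorname{dom}\varphi_0^*}\big(E[XZ]-\varphi_0^*(Z)\big)\quad(X\in L^0(P),\ X\ge0),$$ $$M_u^{\hat\varphi}=\Big\{X\in L^0(P):\ \lim_{N\to\infty}\hat\varphi\big(\alpha|X|\mathbf 1_{\{|X|>N\}}\big)=0\ \ \forall\alpha>0\Big\},\qquad \|X\|_{\hat\varphi}=\inf\{\lambda>0:\hat\varphi(|X|/\lambda)\le1\},\quad \inf\emptyset=\infty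 .$$ Then there is a $\hat Z\in\operatorname{dom}\varphi_0^*$ of maximal support, that is, such that for all $A\in\mathcal F$, $E[\hat Z\mathbf 1_A]=0$ implies $E[Z\mathbf 1_A]=0$ for every $Z\in\operatorname{dom}\varphi_0^*$. For every such $\hat Z$, the formula $dQ/dP=\hat Z/E[\hat Z]$ defines a probability measure $Q\ll P$. Let $\pi:L^0(P)\to L^0(Q)$ be the map sending the $P$-a.s. class of a random variable to its $Q$-a.s. class, and let $M_u^{\hat\varphi}(Q)=\pi(M_u^{\hat\varphi})$. Then $\|\pi(X)\|_{\hat\varphi,Q}:=\|X\|_{\hat\varphi}$ $(X\in L^0(P))$ is well defined on $L^0(Q)$, and $(M_u^{\hat\varphi}(Q),\|\cdot\|_{\hat\varphi,Q})$ is an order continuous Banach lattice, i.e.: 1. $M_u^{\hat\varphi}(Q)$ is a solid vector subspace of $L^0(Q)$ (if $\eta\in M_u^{\hat\varphi}(Q)$ and $|\xi|\le|\eta|$ $Q$-a.s., then $\xi\in M_u^{\hat\varphi}(Q)$), and $\|\cdot\|_{\hat\varphi,Q}$ is a finite norm on it with $\|\xi\|_{\hat\varphi,Q}\le\|\eta\|_{\hat\varphi,Q}$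 whenever $|\xi|\le|\eta|$ $Q$-a.s.; 2. $M_u^{\hat\varphi}(Q)$ is complete for $\|\cdot\|_{\hat\varphi,Q}$; 3. if $\eta\in M_u^{\hat\varphi}(Q)$, $|\xi_n|\le\eta$ $Q$-a.s. for all $n\in\mathbb N$ and $\xi_n\to0$ $Q$-a.s., then $\|\xi_n\|_{\hat\varphi,Q}\to0$. -/

import Mathlib

open MeasureTheory Filter Topology
open scoped ENNReal

namespace LebesgueExtension

variable {Ω : Type*} [MeasurableSpace Ω]

/-- The standing assumption on `φ₀ : L^∞ → ℝ`: it is convex, increasing for the a.s. order,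
vanishes at `0`, and has the Lebesgue property on `L^∞` (continuity along norm-bounded a.s.
convergent sequences). Finiteness is expressed by the codomain `ℝ`. -/
structure IsLebesgueMonotoneConvex (P : Measure Ω) (φ₀ : Lp ℝ ∞ P → ℝ) : Prop where
  convex : ConvexOn ℝ Set.univ φ₀
  monotone : Monotone φ₀
  map_zero : φ₀ 0 = 0
  lebesgue : ∀ (X : ℕ → Lp ℝ ∞ P) (X' : Lp ℝ ∞ P),
    (∃ C : ℝ, ∀ n, ‖X n‖ ≤ C) →
    (∀ᵐ ω ∂P, Tendsto (fun n => X n ω) atTop (𝓝 (X' ω))) →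
    Tendsto (fun n => φ₀ (X n)) atTop (𝓝 (φ₀ X'))

/-- The conjugate `φ₀^*(Z) = sup_{X ∈ L^∞} (E[XZ] - φ₀(X))` for `Z ∈ L^1`. -/
noncomputable def conjugate (P : Measure Ω) (φ₀ : Lp ℝ ∞ P → ℝ) (Z : Lp ℝ 1 P) : EReal :=
  ⨆ X : Lp ℝ ∞ P, (((∫ ω, X ω * Z ω ∂P) - φ₀ X : ℝ) : EReal)

/-- The effective domain of the conjugate. -/
def conjugateDom (P : Measure Ω) (φ₀ : Lp ℝ ∞ P → ℝ) : Set (Lp ℝ 1 P) :=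
  {Z | conjugate P φ₀ Z < ⊤}

/-- The expectation `E[f] = E[f⁺] - E[f⁻]` with values in `[-∞, ∞]`, meaningful for measurable `f`
as soon as `E[f⁺]` or `E[f⁻]` is finite. -/
noncomputable def extExpectation (P : Measure Ω) (f : Ω → ℝ) : EReal :=
  ((∫⁻ ω, ENNReal.ofReal (f ω) ∂P : ℝ≥0∞) : EReal) -
    ((∫⁻ ω, ENNReal.ofReal (-f ω) ∂P : ℝ≥0∞) : EReal)

/-- `φ̂(X) = sup_{Z ∈ dom φ₀^*} (E[XZ] - φ₀^*(Z))`. It depends only on the a.s. class of `X`, and it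
is meaningful when `X⁻ Z` is integrable for all `Z ∈ dom φ₀^*`, in particular for `X ≥ 0`; below it
is only evaluated at nonnegative (measurable) random variables. -/
noncomputable def phiHat (P : Measure Ω) (φ₀ : Lp ℝ ∞ P → ℝ) (X : Ω → ℝ) : EReal :=
  ⨆ Z ∈ conjugateDom P φ₀, (extExpectation P (fun ω => X ω * Z ω) - conjugate P φ₀ Z)

/-- The space `M_u^φ̂` of all `X ∈ L^0` with `φ̂(α |X| 1_{|X| > N}) → 0` as `N → ∞`,
for every `α > 0`. -/
noncomputable def spaceMu (P : Measure Ω) (φ₀ : Lp ℝ ∞ P → ℝ) : Set (Ω →ₘ[P] ℝ) :=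
  {X | ∀ α : ℝ, 0 < α →
    Tendsto (fun N : ℕ =>
        phiHat P φ₀ ({ω | (N : ℝ) < |X ω|}.indicator (fun ω => α * |X ω|)))
      atTop (𝓝 0)}

/-- The gauge `‖X‖_φ̂ = inf {l > 0 : φ̂(|X| / l) ≤ 1}`, with `inf ∅ = ∞`. -/
noncomputable def gaugeNorm (P : Measure Ω) (φ₀ : Lp ℝ ∞ P → ℝ) (X : Ω →ₘ[P] ℝ) : ℝ≥0∞ :=
  ⨅ (l : ℝ) (_ : 0 < l) (_ : phiHat P φ₀ (fun ω => |X ω| / l) ≤ 1), ENNReal.ofReal l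

/-- `Z'` is an element of `dom φ₀^*` of maximal support: every event that is null for `Z' dP` is
null for `Z dP`, for all `Z ∈ dom φ₀^*`. -/
def IsMaximalSupport (P : Measure Ω) (φ₀ : Lp ℝ ∞ P → ℝ) (Z' : Lp ℝ 1 P) : Prop :=
  Z' ∈ conjugateDom P φ₀ ∧
    ∀ A : Set Ω, MeasurableSet A → (∫ ω in A, Z' ω ∂P) = 0 →
      ∀ Z ∈ conjugateDom P φ₀, (∫ ω in A, Z ω ∂P) = 0

/-- The measure `Q` with `dQ/dP = Z / E[Z]`. -/
noncomputable def measureQ (P : Measure Ω) (Z : Lp ℝ 1 P) : Measure Ω :=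
  P.withDensity (fun ω => ENNReal.ofReal (Z ω / ∫ ω', Z ω' ∂P))

theorem measureQ_absolutelyContinuous (P : Measure Ω) (Z : Lp ℝ 1 P) : measureQ P Z ≪ P :=
  withDensity_absolutelyContinuous _ _

/-- The canonical map `π : L^0(P) → L^0(Q)` for `Q ≪ P`, sending a class modulo `P`-a.s. equality
to the class modulo `Q`-a.s. equality of any representative. -/
noncomputable def proj {P Q : Measure Ω} (h : Q ≪ P) (X : Ω →ₘ[P] ℝ) : Ω →ₘ[Q] ℝ :=
  AEEqFun.mk X (X.aestronglyMeasurable.mono_ac h)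

/-- `M_u^φ̂(Q) = π(M_u^φ̂)`. -/
noncomputable def spaceMuQ {P Q : Measure Ω} (h : Q ≪ P) (φ₀ : Lp ℝ ∞ P → ℝ) :
    Set (Ω →ₘ[Q] ℝ) :=
  proj h '' spaceMu P φ₀

/-- `‖ξ‖_{φ̂,Q}`: the gauge of the elements `X ∈ L^0(P)` with `π(X) = ξ`. As a total definition the
infimum over these `X` is taken; that the value is the same for all such `X` is part of the
theorem. -/
noncomputable def gaugeNormQ {P Q : Measure Ω} (h : Q ≪ P) (φ₀ : Lp ℝ ∞ P → ℝ)
    (ξ : Ω →ₘ[Q] ℝ) : ℝ≥0∞ :=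
  ⨅ (X : Ω →ₘ[P] ℝ) (_ : proj h X = ξ), gaugeNorm P φ₀ X

/-- `M ⊆ L^0(Q)` is a solid vector subspace, `N` is a (finite) lattice norm on `M` for which `M` is
complete, and `N` is order continuous with respect to dominated `Q`-a.s. convergence. -/
structure IsOrderContinuousBanachLattice (Q : Measure Ω) (M : Set (Ω →ₘ[Q] ℝ))
    (N : (Ω →ₘ[Q] ℝ) → ℝ≥0∞) : Prop where
  zero_mem : (0 : Ω →ₘ[Q] ℝ) ∈ M
  add_mem : ∀ ξ ∈ M, ∀ η ∈ M, ξ + η ∈ M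
  smul_mem : ∀ (c : ℝ), ∀ ξ ∈ M, c • ξ ∈ M
  solid : ∀ (ξ : Ω →ₘ[Q] ℝ), ∀ η ∈ M, |ξ| ≤ |η| → ξ ∈ M
  norm_lt_top : ∀ ξ ∈ M, N ξ < ⊤
  norm_eq_zero_iff : ∀ ξ ∈ M, (N ξ = 0 ↔ ξ = 0)
  norm_smul : ∀ (c : ℝ), ∀ ξ ∈ M, N (c • ξ) = ENNReal.ofReal |c| * N ξ
  norm_add_le : ∀ ξ ∈ M, ∀ η ∈ M, N (ξ + η) ≤ N ξ + N η
  norm_mono : ∀ ξ ∈ M, ∀ η ∈ M, |ξ| ≤ |η| → N ξ ≤ N η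
  complete : ∀ ξ : ℕ → (Ω →ₘ[Q] ℝ), (∀ n, ξ n ∈ M) →
    (∀ ε : ℝ≥0∞, 0 < ε → ∃ n₀ : ℕ, ∀ m ≥ n₀, ∀ n ≥ n₀, N (ξ m - ξ n) < ε) →
    ∃ ζ ∈ M, Tendsto (fun n => N (ξ n - ζ)) atTop (𝓝 0)
  order_continuous : ∀ (ξ : ℕ → (Ω →ₘ[Q] ℝ)) (η : Ω →ₘ[Q] ℝ), η ∈ M →
    (∀ n, |ξ n| ≤ η) → (∀ᵐ ω ∂Q, Tendsto (fun n => ξ n ω) atTop (𝓝 0)) →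
    Tendsto (fun n => N (ξ n)) atTop (𝓝 0)

end LebesgueExtension

/-!
The argument rests on an identity for the gauge. Let `c(Z) = φ₀^*(Z) ≥ 0` for `Z ∈ dom φ₀^*`. For
`X ≥ 0` and `l > 0`, the condition `φ̂(X / l) ≤ 1` says that `E[XZ] / l - c(Z) ≤ 1` for all `Z`,
that is, `E[XZ] / (1 + c(Z)) ≤ l` for all `Z`. Hence the gauge is a supremum of weighted
`L^1`-seminorms, `‖X‖ = sup_Z ∫ |X| dμ_Z` with `dμ_Z = Z / (1 + c(Z)) dP`
(`gaugeNorm_eq_supLIntegral`), and homogeneity, the triangle inequality, monotonicity and Fatou's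
lemma for it are immediate. Convexity of `φ̂` in the scale `α` shows further that `M_u^φ̂` is the set
of `X` whose truncations approximate `|X|` in gauge: `inf_K ‖(|X| - K)⁺‖ = 0` (`mem_spaceMu_iff`).

Apart from this, three facts about the family `(μ_Z)` are needed, and
`isOrderContinuousBanachLattice_boundedClosure` derives the whole lattice structure from them.

* Every `μ_Z` is absolutely continuous with respect to `Q`; this is the maximality of the support.
  Therefore nothing changes when `P`-classes are replaced by `Q`-classes.
* The gauge dominates a multiple of the norm of `L^1(Q)`, since `Q` is a multiple of one of
  the `μ_Z`. A Cauchy sequence therefore has a subsequence that converges `Q`-a.s., and Fatou's lemma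
  makes the limit a limit in gauge.
* The gauge has the Lebesgue property (`hasLebesgueProperty_gaugeMeasure`), inherited from `φ₀`
  through `E[XZ] ≤ φ₀(X) + c(Z)`. Splitting at a level `K` extends it from bounded sequences to
  sequences dominated by an element of `M_u^φ̂(Q)`.

That `dom φ₀^*` is large enough is a matter of duality. By the Hahn–Banach theorem `φ₀` is a supremum
of continuous affine functions on `L^∞`. If `l + c ≤ φ₀` with `l` linear, then
`l(X_n) ≤ (φ₀(a X_n) - c) / a` for all `a > 0`, so the Lebesgue property of `φ₀` makes `l` continuous
for bounded a.s. convergence, hence countably additive on indicators, and the Radon–Nikodym theorem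
represents it by some `Z ∈ L^1` (`exists_density`, `exists_conjugate_le`). This yields `φ̂ ≥ 0`
and a nonzero element of `dom φ₀^*`. Elements of maximal support exist by exhaustion, because
`dom φ₀^*` is stable under suitable countable convex combinations (`exists_isMaximalSupport`).
-/

namespace LebesgueExtension

variable {Ω : Type*} [MeasurableSpace Ω]

/-! ### Suprema of families of integrals -/

/-- The sublinear functional `f ↦ sup_i ∫ f dμ_i` of a family of measures, on `[0, ∞]`-valued
functions. -/
noncomputable def supLIntegral {ι : Type*} (μ : ι → Measure Ω) (f : Ω → ℝ≥0∞) : ℝ≥0∞ :=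
  ⨆ i, ∫⁻ ω, f ω ∂μ i

section SupLIntegral

variable {ι : Type*} {μ : ι → Measure Ω} {Q : Measure Ω} {f g : Ω → ℝ≥0∞}

theorem lintegral_le_supLIntegral (i : ι) : ∫⁻ ω, f ω ∂μ i ≤ supLIntegral μ f :=
  le_iSup (fun i => ∫⁻ ω, f ω ∂μ i) i

theorem supLIntegral_mono_ae (hac : ∀ i, μ i ≪ Q) (h : ∀ᵐ ω ∂Q, f ω ≤ g ω) :
    supLIntegral μ f ≤ supLIntegral μ g :=
  iSup_mono fun i => lintegral_mono_ae ((hac i).ae_le h)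

theorem supLIntegral_mono (h : ∀ ω, f ω ≤ g ω) : supLIntegral μ f ≤ supLIntegral μ g :=
  iSup_mono fun _ => lintegral_mono h

theorem supLIntegral_congr_ae (hac : ∀ i, μ i ≪ Q) (h : ∀ᵐ ω ∂Q, f ω = g ω) :
    supLIntegral μ f = supLIntegral μ g :=
  iSup_congr fun i => lintegral_congr_ae ((hac i).ae_le h)

theorem supLIntegral_add_le (hf : Measurable f) :
    supLIntegral μ (fun ω => f ω + g ω) ≤ supLIntegral μ f + supLIntegral μ g :=
  iSup_le fun i => by
    rw [lintegral_add_left hf]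
    exact add_le_add (lintegral_le_supLIntegral i) (lintegral_le_supLIntegral i)

theorem supLIntegral_const_mul {r : ℝ≥0∞} (hr : r ≠ ∞) :
    supLIntegral μ (fun ω => r * f ω) = r * supLIntegral μ f := by
  simp only [supLIntegral, ENNReal.mul_iSup, lintegral_const_mul' _ _ hr]

theorem supLIntegral_zero : supLIntegral μ (fun _ => 0) = 0 := by
  simp [supLIntegral]

/-- Fatou's lemma for a supremum of integrals. -/
theorem supLIntegral_le_of_tendsto (hac : ∀ i, μ i ≪ Q) {F : ℕ → Ω → ℝ≥0∞}
    (hF : ∀ n, Measurable (F n)) (hlim : ∀ᵐ ω ∂Q, Tendsto (fun n => F n ω) atTop (𝓝 (f ω)))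
    {ε : ℝ≥0∞} (hε : ∀ᶠ n in atTop, supLIntegral μ (F n) ≤ ε) : supLIntegral μ f ≤ ε := by
  refine iSup_le fun i => ?_
  calc ∫⁻ ω, f ω ∂μ i = ∫⁻ ω, liminf (fun n => F n ω) atTop ∂μ i :=
        lintegral_congr_ae ((hac i).ae_le (hlim.mono fun ω h => h.liminf_eq.symm))
    _ ≤ liminf (fun n => ∫⁻ ω, F n ω ∂μ i) atTop := lintegral_liminf_le hF
    _ ≤ ε := by
        refine liminf_le_of_frequently_le' (Eventually.frequently ?_)
        filter_upwards [hε] with n hn using (lintegral_le_supLIntegral i).trans hn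

end SupLIntegral

/-! ### The closure of the bounded functions -/

theorem measurable_enorm_aeEqFun {Q : Measure Ω} (ξ : Ω →ₘ[Q] ℝ) :
    Measurable fun ω => ‖ξ ω‖ₑ :=
  ξ.measurable.enorm

theorem enorm_ae_le_of_abs_le {Q : Measure Ω} {ξ η : Ω →ₘ[Q] ℝ} (h : |ξ| ≤ |η|) :
    ∀ᵐ ω ∂Q, ‖ξ ω‖ₑ ≤ ‖η ω‖ₑ := by
  filter_upwards [AEEqFun.coeFn_le.2 h, AEEqFun.coeFn_abs ξ, AEEqFun.coeFn_abs η] with ω h h1 h2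
  rw [h1, h2] at h
  exact enorm_le_iff_norm_le.2 h

/-- The closure of the bounded functions in `L^0(Q)` for the gauge `f ↦ sup_i ∫ |f| dμ_i`, encoded
by truncation: the excess `(|ξ| - K)⁺` over a suitable level `K` has arbitrarily small gauge. The
subtraction in `[0, ∞]` is truncated. -/
def boundedClosure {ι : Type*} (μ : ι → Measure Ω) (Q : Measure Ω) : Set (Ω →ₘ[Q] ℝ) :=
  {ξ | ∀ ε : ℝ≥0∞, 0 < ε → ∃ K : NNReal, supLIntegral μ (fun ω => ‖ξ ω‖ₑ - K) ≤ ε}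

section BoundedClosure

variable {ι : Type*} {μ : ι → Measure Ω} {Q : Measure Ω}

theorem boundedClosure_of_ae_le (hac : ∀ i, μ i ≪ Q) {ξ η : Ω →ₘ[Q] ℝ}
    (hη : η ∈ boundedClosure μ Q) (h : ∀ᵐ ω ∂Q, ‖ξ ω‖ₑ ≤ ‖η ω‖ₑ) : ξ ∈ boundedClosure μ Q := by
  intro ε hε
  obtain ⟨K, hK⟩ := hη ε hε
  exact ⟨K, (supLIntegral_mono_ae hac (h.mono fun ω h => tsub_le_tsub_right h _)).trans hK⟩

theorem boundedClosure_zero (hac : ∀ i, μ i ≪ Q) : (0 : Ω →ₘ[Q] ℝ) ∈ boundedClosure μ Q := by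
  refine fun ε _ => ⟨0, ?_⟩
  have h : ∀ᵐ ω ∂Q, ‖(0 : Ω →ₘ[Q] ℝ) ω‖ₑ - ((0 : NNReal) : ℝ≥0∞) = 0 := by
    filter_upwards [AEEqFun.coeFn_zero (α := Ω) (μ := Q) (β := ℝ)] with ω h
    simp [h]
  rw [supLIntegral_congr_ae hac h, supLIntegral_zero]
  exact zero_le

theorem boundedClosure_add (hac : ∀ i, μ i ≪ Q) {ξ η : Ω →ₘ[Q] ℝ}
    (hξ : ξ ∈ boundedClosure μ Q) (hη : η ∈ boundedClosure μ Q) :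
    ξ + η ∈ boundedClosure μ Q := by
  intro ε hε
  obtain ⟨K, hK⟩ := hξ (ε / 2) (ENNReal.half_pos hε.ne')
  obtain ⟨L, hL⟩ := hη (ε / 2) (ENNReal.half_pos hε.ne')
  refine ⟨K + L, ?_⟩
  calc supLIntegral μ (fun ω => ‖(ξ + η) ω‖ₑ - ((K + L : NNReal) : ℝ≥0∞))
      ≤ supLIntegral μ (fun ω => (‖ξ ω‖ₑ - K) + (‖η ω‖ₑ - L)) := by
        refine supLIntegral_mono_ae hac ?_
        filter_upwards [AEEqFun.coeFn_add ξ η] with ω h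
        rw [h, ENNReal.coe_add]
        exact (tsub_le_tsub_right (enorm_add_le _ _) _).trans add_tsub_add_le_tsub_add_tsub
    _ ≤ ε / 2 + ε / 2 :=
        (supLIntegral_add_le ((measurable_enorm_aeEqFun ξ).sub_const _)).trans (add_le_add hK hL)
    _ = ε := ENNReal.add_halves ε

theorem supLIntegral_enorm_smul (hac : ∀ i, μ i ≪ Q) (c : ℝ) (ξ : Ω →ₘ[Q] ℝ) :
    supLIntegral μ (fun ω => ‖(c • ξ) ω‖ₑ) =
      ENNReal.ofReal |c| * supLIntegral μ (fun ω => ‖ξ ω‖ₑ) := by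
  rw [← supLIntegral_const_mul ENNReal.ofReal_ne_top]
  refine supLIntegral_congr_ae hac ?_
  filter_upwards [AEEqFun.coeFn_smul c ξ] with ω h
  rw [h, Pi.smul_apply, enorm_smul, Real.enorm_eq_ofReal_abs]

theorem boundedClosure_smul (hac : ∀ i, μ i ≪ Q) (c : ℝ) {ξ : Ω →ₘ[Q] ℝ}
    (hξ : ξ ∈ boundedClosure μ Q) : c • ξ ∈ boundedClosure μ Q := by
  rcases eq_or_ne c 0 with rfl | hc
  · rw [zero_smul]
    exact boundedClosure_zero hac
  intro ε hε
  have hc0 : ‖c‖ₑ ≠ 0 := by simpa using hc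
  obtain ⟨K, hK⟩ := hξ (ε / ‖c‖ₑ) (ENNReal.div_pos hε.ne' enorm_ne_top)
  refine ⟨‖c‖₊ * K, ?_⟩
  calc supLIntegral μ (fun ω => ‖(c • ξ) ω‖ₑ - ((‖c‖₊ * K : NNReal) : ℝ≥0∞))
      = supLIntegral μ (fun ω => ‖c‖ₑ * (‖ξ ω‖ₑ - K)) := by
        refine supLIntegral_congr_ae hac ?_
        filter_upwards [AEEqFun.coeFn_smul c ξ] with ω h
        rw [h, Pi.smul_apply, enorm_smul, ENNReal.coe_mul,
          ENNReal.mul_sub fun _ _ => enorm_ne_top]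
        rfl
    _ = ‖c‖ₑ * supLIntegral μ (fun ω => ‖ξ ω‖ₑ - K) := supLIntegral_const_mul enorm_ne_top
    _ ≤ ‖c‖ₑ * (ε / ‖c‖ₑ) := by gcongr
    _ = ε := ENNReal.mul_div_cancel hc0 enorm_ne_top

/-- Splitting a function at the level `K` into its excess over `K` and a bounded part. -/
theorem supLIntegral_le_add_truncation {f : Ω → ℝ≥0∞} (hf : Measurable f) (K : ℝ≥0∞) :
    supLIntegral μ f ≤
      supLIntegral μ (fun ω => f ω - K) + supLIntegral μ (fun ω => min (f ω) K) := by
  refine le_trans (supLIntegral_mono fun ω => ?_) (supLIntegral_add_le (hf.sub_const K))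
  rw [tsub_add_min]

/-- The Lebesgue property of `f ↦ sup_i ∫ f dμ_i`: continuity at `0` along uniformly bounded
sequences that tend to `0` almost everywhere. -/
def HasLebesgueProperty {ι : Type*} (μ : ι → Measure Ω) (Q : Measure Ω) : Prop :=
  ∀ (f : ℕ → Ω → ℝ≥0∞) (C : NNReal), (∀ n, Measurable (f n)) → (∀ n ω, f n ω ≤ C) →
    (∀ᵐ ω ∂Q, Tendsto (fun n => f n ω) atTop (𝓝 0)) →
    Tendsto (fun n => supLIntegral μ (f n)) atTop (𝓝 0)

theorem HasLebesgueProperty.supLIntegral_one_lt_top (hleb : HasLebesgueProperty μ Q) :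
    supLIntegral μ (fun _ => 1) < ∞ := by
  have hbd : ∀ n : ℕ, ((n : ℝ≥0∞) + 1)⁻¹ ≤ ((1 : NNReal) : ℝ≥0∞) := fun n => by simp
  have hlim : Tendsto (fun n : ℕ => ((n : ℝ≥0∞) + 1)⁻¹) atTop (𝓝 0) := by
    simpa using (tendsto_add_atTop_iff_nat 1).2 ENNReal.tendsto_inv_nat_nhds_zero
  have h := hleb (fun n _ => ((n : ℝ≥0∞) + 1)⁻¹) 1 (fun n => measurable_const)
    (fun n _ => hbd n) (Eventually.of_forall fun _ => hlim)
  obtain ⟨n, hn⟩ := (ENNReal.tendsto_nhds_zero.1 h 1 one_pos).exists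
  have hn0 : ((n : ℝ≥0∞) + 1)⁻¹ ≠ 0 := by
    simp
  have heq := supLIntegral_const_mul (μ := μ) (f := fun _ => 1) (r := ((n : ℝ≥0∞) + 1)⁻¹)
    (by simp)
  simp only [mul_one] at heq
  rw [heq] at hn
  by_contra htop
  rw [not_lt, top_le_iff] at htop
  rw [htop, ENNReal.mul_top hn0] at hn
  exact absurd hn (by simp)

theorem supLIntegral_lt_top_of_mem (hleb : HasLebesgueProperty μ Q) {ξ : Ω →ₘ[Q] ℝ}
    (hξ : ξ ∈ boundedClosure μ Q) : supLIntegral μ (fun ω => ‖ξ ω‖ₑ) < ∞ := by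
  obtain ⟨K, hK⟩ := hξ 1 one_pos
  refine (supLIntegral_le_add_truncation (measurable_enorm_aeEqFun ξ) K).trans_lt
    (ENNReal.add_lt_top.2 ⟨hK.trans_lt ENNReal.one_lt_top, ?_⟩)
  calc supLIntegral μ (fun ω => min ‖ξ ω‖ₑ K) ≤ supLIntegral μ (fun _ => K * 1) :=
        supLIntegral_mono fun ω => by simp
    _ = K * supLIntegral μ (fun _ => 1) := supLIntegral_const_mul ENNReal.coe_ne_top
    _ < ∞ := ENNReal.mul_lt_top ENNReal.coe_lt_top hleb.supLIntegral_one_lt_top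

theorem supLIntegral_enorm_add_le (hac : ∀ i, μ i ≪ Q) (ξ η : Ω →ₘ[Q] ℝ) :
    supLIntegral μ (fun ω => ‖(ξ + η) ω‖ₑ) ≤
      supLIntegral μ (fun ω => ‖ξ ω‖ₑ) + supLIntegral μ (fun ω => ‖η ω‖ₑ) := by
  refine le_trans (supLIntegral_mono_ae hac ?_)
    (supLIntegral_add_le (measurable_enorm_aeEqFun ξ))
  filter_upwards [AEEqFun.coeFn_add ξ η] with ω h
  rw [h]
  exact enorm_add_le _ _

theorem supLIntegral_eq_zero_iff (hac : ∀ i, μ i ≪ Q) {C : ℝ≥0∞}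
    (hdom : ∀ f : Ω → ℝ≥0∞, ∫⁻ ω, f ω ∂Q ≤ C * supLIntegral μ f) (ξ : Ω →ₘ[Q] ℝ) :
    supLIntegral μ (fun ω => ‖ξ ω‖ₑ) = 0 ↔ ξ = 0 := by
  constructor
  · intro h
    have h0 : ∫⁻ ω, ‖ξ ω‖ₑ ∂Q = 0 := by
      have := hdom fun ω => ‖ξ ω‖ₑ
      rwa [h, mul_zero, nonpos_iff_eq_zero] at this
    rw [lintegral_eq_zero_iff (measurable_enorm_aeEqFun ξ)] at h0
    refine AEEqFun.ext ?_
    filter_upwards [h0, AEEqFun.coeFn_zero (α := Ω) (μ := Q) (β := ℝ)] with ω h h'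
    rw [h']
    simpa using h
  · rintro rfl
    rw [← supLIntegral_zero (μ := μ)]
    refine supLIntegral_congr_ae hac ?_
    filter_upwards [AEEqFun.coeFn_zero (α := Ω) (μ := Q) (β := ℝ)] with ω h
    simp [h]

/-- A limit in gauge of elements of the closure of the bounded functions belongs to it. -/
theorem boundedClosure_of_approx (hac : ∀ i, μ i ≪ Q) {ζ : Ω →ₘ[Q] ℝ}
    (h : ∀ ε : ℝ≥0∞, 0 < ε → ∃ ξ ∈ boundedClosure μ Q,
      supLIntegral μ (fun ω => ‖(ξ - ζ) ω‖ₑ) ≤ ε) : ζ ∈ boundedClosure μ Q := by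
  intro ε hε
  obtain ⟨ξ, hξ, hdist⟩ := h (ε / 2) (ENNReal.half_pos hε.ne')
  obtain ⟨K, hK⟩ := hξ (ε / 2) (ENNReal.half_pos hε.ne')
  refine ⟨K, ?_⟩
  calc supLIntegral μ (fun ω => ‖ζ ω‖ₑ - K)
      ≤ supLIntegral μ (fun ω => (‖ξ ω‖ₑ - K) + ‖(ξ - ζ) ω‖ₑ) := by
        refine supLIntegral_mono_ae hac ?_
        filter_upwards [AEEqFun.coeFn_sub ξ ζ] with ω h
        rw [h, Pi.sub_apply]
        have h1 : ‖ζ ω‖ₑ ≤ ‖ξ ω‖ₑ + ‖ξ ω - ζ ω‖ₑ := by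
          calc ‖ζ ω‖ₑ = ‖ξ ω - (ξ ω - ζ ω)‖ₑ := by rw [sub_sub_cancel]
            _ ≤ _ := enorm_sub_le
        rw [tsub_le_iff_right, add_right_comm]
        exact h1.trans (add_le_add_left le_tsub_add _)
    _ ≤ ε / 2 + ε / 2 :=
        (supLIntegral_add_le ((measurable_enorm_aeEqFun ξ).sub_const _)).trans
          (add_le_add hK hdist)
    _ = ε := ENNReal.add_halves ε

/-- Completeness. The gauge dominates the norm of `L^1(Q)`, so a fast Cauchy sequence converges
almost everywhere, and Fatou's lemma turns the almost sure limit into a limit in gauge. -/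
theorem boundedClosure_complete (hac : ∀ i, μ i ≪ Q) {C : ℝ≥0∞} (hC : C ≠ ∞)
    (hdom : ∀ f : Ω → ℝ≥0∞, ∫⁻ ω, f ω ∂Q ≤ C * supLIntegral μ f)
    (ξ : ℕ → (Ω →ₘ[Q] ℝ)) (hξ : ∀ n, ξ n ∈ boundedClosure μ Q)
    (hcau : ∀ ε : ℝ≥0∞, 0 < ε → ∃ n₀ : ℕ, ∀ m ≥ n₀, ∀ n ≥ n₀,
      supLIntegral μ (fun ω => ‖(ξ m - ξ n) ω‖ₑ) < ε) :
    ∃ ζ ∈ boundedClosure μ Q,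
      Tendsto (fun n => supLIntegral μ (fun ω => ‖(ξ n - ζ) ω‖ₑ)) atTop (𝓝 0) := by
  have hpow : ∀ k : ℕ, (0 : ℝ≥0∞) < 2⁻¹ ^ k := fun k => ENNReal.pow_pos (by simp) k
  have hpow' : ∀ k : ℕ, (2⁻¹ : ℝ≥0∞) ^ k ≠ ∞ := fun k => ENNReal.pow_ne_top (by simp)
  -- a subsequence along which the Cauchy condition holds with the rate `2⁻ᵏ`
  obtain ⟨φ, hφ, hφcau⟩ := extraction_forall_of_eventually
    (P := fun k N => ∀ m ≥ N, ∀ n ≥ N,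
      supLIntegral μ (fun ω => ‖(ξ m - ξ n) ω‖ₑ) < 2⁻¹ ^ k) fun k => by
      obtain ⟨n₀, h⟩ := hcau _ (hpow k)
      filter_upwards [eventually_ge_atTop n₀] with N hN m hm n hn
      exact h m (hN.trans hm) n (hN.trans hn)
  have hae : ∀ᵐ ω ∂Q, ∃ l : ℝ, Tendsto (fun k => ξ (φ k) ω) atTop (𝓝 l) := by
    refine Lp.ae_tendsto_of_cauchy_eLpNorm (p := 1) (B := fun k => (C + 1) * 2⁻¹ ^ k)
      (f := fun k => ξ (φ k)) (fun k => (ξ (φ k)).aestronglyMeasurable) le_rfl ?_ ?_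
    · rw [ENNReal.tsum_mul_left]
      refine ENNReal.mul_ne_top (ENNReal.add_ne_top.2 ⟨hC, ENNReal.one_ne_top⟩) ?_
      rw [ENNReal.tsum_geometric]
      simp
    · intro N n m hn hm
      have h := hφcau N (φ n) (hφ.monotone hn) (φ m) (hφ.monotone hm)
      rw [eLpNorm_one_eq_lintegral_enorm]
      calc ∫⁻ ω, ‖(ξ (φ n) - ξ (φ m) : Ω → ℝ) ω‖ₑ ∂Q
          = ∫⁻ ω, ‖(ξ (φ n) - ξ (φ m)) ω‖ₑ ∂Q := by
            refine lintegral_congr_ae ?_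
            filter_upwards [AEEqFun.coeFn_sub (ξ (φ n)) (ξ (φ m))] with ω h
            rw [h]
        _ ≤ C * supLIntegral μ (fun ω => ‖(ξ (φ n) - ξ (φ m)) ω‖ₑ) := hdom _
        _ ≤ C * 2⁻¹ ^ N := by gcongr
        _ < (C + 1) * 2⁻¹ ^ N := by
            rw [add_mul, one_mul]
            exact ENNReal.lt_add_right (ENNReal.mul_ne_top hC (hpow' N)) (hpow N).ne'
  obtain ⟨z, hz, hzlim⟩ := exists_stronglyMeasurable_limit_of_tendsto_ae
    (fun k => (ξ (φ k)).aestronglyMeasurable) hae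
  set ζ : Ω →ₘ[Q] ℝ := AEEqFun.mk z hz.aestronglyMeasurable with hζ
  have hclose : ∀ ε : ℝ≥0∞, 0 < ε →
      ∀ᶠ n in atTop, supLIntegral μ (fun ω => ‖(ξ n - ζ) ω‖ₑ) ≤ ε := by
    intro ε hε
    obtain ⟨n₀, h⟩ := hcau ε hε
    filter_upwards [eventually_ge_atTop n₀] with n hn
    refine supLIntegral_le_of_tendsto hac (F := fun k ω => ‖(ξ n - ξ (φ k)) ω‖ₑ)
      (fun k => measurable_enorm_aeEqFun _) ?_ ?_
    · filter_upwards [hzlim, AEEqFun.coeFn_mk z hz.aestronglyMeasurable, AEEqFun.coeFn_sub (ξ n) ζ,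
        ae_all_iff.2 fun k => AEEqFun.coeFn_sub (ξ n) (ξ (φ k))] with ω h1 h2 h3 h4
      simp only [h3, h4, Pi.sub_apply]
      rw [hζ, h2]
      exact (tendsto_const_nhds.sub h1).enorm
    · filter_upwards [hφ.tendsto_atTop.eventually_ge_atTop n₀] with k hk
      exact (h n hn _ hk).le
  refine ⟨ζ, boundedClosure_of_approx hac fun ε hε => ?_, ENNReal.tendsto_nhds_zero.2 hclose⟩
  obtain ⟨n, hn⟩ := (hclose ε hε).exists
  exact ⟨ξ n, hξ n, hn⟩

theorem boundedClosure_orderContinuous (hac : ∀ i, μ i ≪ Q) (hleb : HasLebesgueProperty μ Q)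
    (ξ : ℕ → (Ω →ₘ[Q] ℝ)) (η : Ω →ₘ[Q] ℝ) (hη : η ∈ boundedClosure μ Q)
    (hle : ∀ n, |ξ n| ≤ η) (hlim : ∀ᵐ ω ∂Q, Tendsto (fun n => ξ n ω) atTop (𝓝 0)) :
    Tendsto (fun n => supLIntegral μ (fun ω => ‖ξ n ω‖ₑ)) atTop (𝓝 0) := by
  refine ENNReal.tendsto_nhds_zero.2 fun ε hε => ?_
  have hε2 := ENNReal.half_pos hε.ne'
  obtain ⟨K, hK⟩ := hη _ hε2
  have htrunc := hleb (fun n ω => min ‖ξ n ω‖ₑ K) K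
    (fun n => (measurable_enorm_aeEqFun _).min measurable_const) (fun n ω => min_le_right _ _)
    (by
      filter_upwards [hlim] with ω h
      have h0 : Tendsto (fun n => ‖ξ n ω‖ₑ) atTop (𝓝 0) := by simpa using h.enorm
      exact tendsto_of_tendsto_of_tendsto_of_le_of_le tendsto_const_nhds h0
        (fun _ => zero_le) fun _ => min_le_left _ _)
  filter_upwards [ENNReal.tendsto_nhds_zero.1 htrunc _ hε2] with n hn
  calc supLIntegral μ (fun ω => ‖ξ n ω‖ₑ)
      ≤ supLIntegral μ (fun ω => ‖ξ n ω‖ₑ - K) + supLIntegral μ (fun ω => min ‖ξ n ω‖ₑ K) :=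
        supLIntegral_le_add_truncation (measurable_enorm_aeEqFun _) K
    _ ≤ ε / 2 + ε / 2 := by
        refine add_le_add (le_trans (supLIntegral_mono_ae hac ?_) hK) hn
        filter_upwards [enorm_ae_le_of_abs_le ((hle n).trans (le_abs_self η))] with ω h
        exact tsub_le_tsub_right h _
    _ = ε := ENNReal.add_halves ε

/-- Let `(μ_i)` be a family of measures absolutely continuous with respect to `Q` whose supremum
dominates `L^1(Q)` and has the Lebesgue property. Then the closure of the bounded functions is an
order continuous Banach lattice for the gauge `ξ ↦ sup_i ∫ |ξ| dμ_i`. -/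
theorem isOrderContinuousBanachLattice_boundedClosure (hac : ∀ i, μ i ≪ Q) {C : ℝ≥0∞}
    (hC : C ≠ ∞) (hdom : ∀ f : Ω → ℝ≥0∞, ∫⁻ ω, f ω ∂Q ≤ C * supLIntegral μ f)
    (hleb : HasLebesgueProperty μ Q) :
    IsOrderContinuousBanachLattice Q (boundedClosure μ Q)
      (fun ξ => supLIntegral μ (fun ω => ‖ξ ω‖ₑ)) where
  zero_mem := boundedClosure_zero hac
  add_mem _ hξ _ hη := boundedClosure_add hac hξ hη
  smul_mem c _ hξ := boundedClosure_smul hac c hξ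
  solid _ _ hη h := boundedClosure_of_ae_le hac hη (enorm_ae_le_of_abs_le h)
  norm_lt_top _ hξ := supLIntegral_lt_top_of_mem hleb hξ
  norm_eq_zero_iff ξ _ := supLIntegral_eq_zero_iff hac hdom ξ
  norm_smul c ξ _ := supLIntegral_enorm_smul hac c ξ
  norm_add_le ξ _ η _ := supLIntegral_enorm_add_le hac ξ η
  norm_mono _ _ _ _ h := supLIntegral_mono_ae hac (enorm_ae_le_of_abs_le h)
  complete := boundedClosure_complete hac hC hdom
  order_continuous := boundedClosure_orderContinuous hac hleb

end BoundedClosure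

/-! ### Bounded almost sure convergence and the conjugate -/

section Duality

variable {P : Measure Ω} {φ₀ : Lp ℝ ∞ P → ℝ}

theorem ae_norm_le_norm_Lp_top (X : Lp ℝ ∞ P) : ∀ᵐ ω ∂P, ‖X ω‖ ≤ ‖X‖ := by
  filter_upwards [ae_le_eLpNormEssSup (f := X) (μ := P)] with ω h
  rw [Lp.norm_def, eLpNorm_exponent_top, ← toReal_enorm]
  refine ENNReal.toReal_mono ?_ h
  rw [← eLpNorm_exponent_top]
  exact Lp.eLpNorm_ne_top X

theorem Lp_smul_nonneg {p : ℝ≥0∞} {a : ℝ} (ha : 0 ≤ a) {f : Lp ℝ p P} (hf : 0 ≤ f) :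
    0 ≤ a • f := by
  rw [← Lp.coeFn_nonneg] at hf ⊢
  filter_upwards [hf, Lp.coeFn_smul a f] with ω h1 h2
  rw [h2]
  exact mul_nonneg ha h1

/-- The duality pairing `(X, Z) ↦ E[XZ]` of `L^∞` and `L^1`. -/
noncomputable def pairing (P : Measure Ω) : Lp ℝ ∞ P →L[ℝ] Lp ℝ 1 P →L[ℝ] ℝ :=
  (ContinuousLinearMap.mul ℝ ℝ).lpPairing P ∞ 1

theorem pairing_apply (X : Lp ℝ ∞ P) (Z : Lp ℝ 1 P) : pairing P X Z = ∫ ω, X ω * Z ω ∂P := by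
  rw [pairing, ContinuousLinearMap.lpPairing_eq_integral]
  rfl

/-- The sequence `X` is norm bounded in `L^∞` and tends to `0` almost surely. -/
def BoundedTendstoZero (X : ℕ → Lp ℝ ∞ P) : Prop :=
  (∃ C : ℝ, ∀ n, ‖X n‖ ≤ C) ∧ ∀ᵐ ω ∂P, Tendsto (fun n => X n ω) atTop (𝓝 0)

theorem BoundedTendstoZero.smul {X : ℕ → Lp ℝ ∞ P} (hX : BoundedTendstoZero X) (a : ℝ) :
    BoundedTendstoZero fun n => a • X n := by
  obtain ⟨⟨C, hC⟩, h⟩ := hX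
  refine ⟨⟨‖a‖ * C, fun n => ?_⟩, ?_⟩
  · rw [_root_.norm_smul]
    exact mul_le_mul_of_nonneg_left (hC n) (norm_nonneg a)
  · filter_upwards [h, ae_all_iff.2 fun n => Lp.coeFn_smul a (X n)] with ω h1 h2
    simp only [h2, Pi.smul_apply, smul_eq_mul]
    simpa using h1.const_mul a

theorem IsLebesgueMonotoneConvex.tendsto_zero (hφ₀ : IsLebesgueMonotoneConvex P φ₀)
    {X : ℕ → Lp ℝ ∞ P} (hX : BoundedTendstoZero X) :
    Tendsto (fun n => φ₀ (X n)) atTop (𝓝 0) := by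
  rw [← hφ₀.map_zero]
  refine hφ₀.lebesgue X 0 hX.1 ?_
  filter_upwards [hX.2, Lp.coeFn_zero ℝ ∞ P] with ω h h0
  rw [h0]
  exact h

theorem pairing_tendsto_zero (Z : Lp ℝ 1 P) {X : ℕ → Lp ℝ ∞ P} (hX : BoundedTendstoZero X) :
    Tendsto (fun n => pairing P (X n) Z) atTop (𝓝 0) := by
  obtain ⟨⟨C, hC⟩, h⟩ := hX
  simp only [pairing_apply]
  rw [← integral_zero Ω ℝ (μ := P)]
  refine tendsto_integral_of_dominated_convergence (fun ω => C * ‖Z ω‖)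
    (fun n => (Lp.aestronglyMeasurable _).mul (Lp.aestronglyMeasurable _))
    ((L1.integrable_coeFn Z).norm.const_mul C) (fun n => ?_) ?_
  · filter_upwards [ae_norm_le_norm_Lp_top (X n)] with ω hω
    rw [norm_mul]
    exact mul_le_mul_of_nonneg_right (hω.trans (hC n)) (norm_nonneg _)
  · filter_upwards [h] with ω hω
    simpa using hω.mul_const (Z ω)

/-- An affine minorant of a functional with the Lebesgue property has a linear part that is
continuous for bounded a.s. convergence: `l (a X) + c ≤ φ₀ (a X)` bounds `l X` by about `- c / a`,
and `a` is arbitrary. -/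
theorem tendsto_zero_of_affine_le (hφ₀ : IsLebesgueMonotoneConvex P φ₀)
    {l : Lp ℝ ∞ P →L[ℝ] ℝ} {c : ℝ} (hl : ∀ X, l X + c ≤ φ₀ X) {X : ℕ → Lp ℝ ∞ P}
    (hX : BoundedTendstoZero X) : Tendsto (fun n => l (X n)) atTop (𝓝 0) := by
  have hc : 0 < 1 - c := by
    have := hl 0
    rw [map_zero, hφ₀.map_zero] at this
    linarith
  have key : ∀ Y : ℕ → Lp ℝ ∞ P, BoundedTendstoZero Y → ∀ ε : ℝ, 0 < ε →
      ∀ᶠ n in atTop, l (Y n) < ε := by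
    intro Y hY ε hε
    have ha : 0 < (1 - c) / ε := div_pos hc hε
    filter_upwards [(hφ₀.tendsto_zero (hY.smul ((1 - c) / ε))).eventually_lt_const one_pos]
      with n hn
    have h1 := hl (((1 - c) / ε) • Y n)
    rw [map_smul, smul_eq_mul] at h1
    have h2 : (1 - c) / ε * l (Y n) < (1 - c) / ε * ε := by
      rw [div_mul_cancel₀ _ hε.ne']
      linarith
    exact lt_of_mul_lt_mul_left h2 ha.le
  rw [Metric.tendsto_atTop']
  intro ε hε
  have hev := (key X hX ε hε).and (key _ (hX.smul (-1)) ε hε)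
  obtain ⟨N, hN⟩ := eventually_atTop.1 hev
  refine ⟨N, fun n hn => ?_⟩
  have h := hN n (le_of_lt hn)
  rw [Real.dist_eq, sub_zero, abs_lt]
  have h2 := h.2
  rw [map_smul, smul_eq_mul] at h2
  exact ⟨by linarith, h.1⟩

theorem IsLebesgueMonotoneConvex.continuous (hφ₀ : IsLebesgueMonotoneConvex P φ₀) :
    Continuous φ₀ := by
  refine continuous_iff_seqContinuous.2 fun X X' hX => ?_
  refine hφ₀.lebesgue X X' ?_ ?_
  · obtain ⟨C, hC⟩ := (Metric.isBounded_range_of_tendsto X hX).exists_norm_le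
    exact ⟨C, fun n => hC _ ⟨n, rfl⟩⟩
  · filter_upwards [ae_all_iff.2 fun n => ae_norm_le_norm_Lp_top (X n - X'),
      ae_all_iff.2 fun n => Lp.coeFn_sub (X n) X'] with ω h1 h2
    rw [tendsto_iff_norm_sub_tendsto_zero] at hX ⊢
    refine squeeze_zero (fun n => norm_nonneg _) (fun n => ?_) hX
    have := h1 n
    rwa [h2, Pi.sub_apply] at this

theorem conjugate_le_coe_iff {Z : Lp ℝ 1 P} {c : ℝ} :
    conjugate P φ₀ Z ≤ c ↔ ∀ X, pairing P X Z ≤ φ₀ X + c := by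
  simp only [conjugate, iSup_le_iff, EReal.coe_le_coe_iff, pairing_apply, sub_le_iff_le_add']

theorem conjugate_nonneg (hφ₀ : IsLebesgueMonotoneConvex P φ₀) (Z : Lp ℝ 1 P) :
    0 ≤ conjugate P φ₀ Z := by
  refine le_trans (le_of_eq ?_) (le_iSup _ (0 : Lp ℝ ∞ P))
  rw [← pairing_apply, map_zero, hφ₀.map_zero]
  simp

theorem coe_toReal_conjugate (hφ₀ : IsLebesgueMonotoneConvex P φ₀) {Z : Lp ℝ 1 P}
    (hZ : Z ∈ conjugateDom P φ₀) :
    (((conjugate P φ₀ Z).toReal : ℝ) : EReal) = conjugate P φ₀ Z :=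
  EReal.coe_toReal (ne_of_lt hZ)
    (ne_of_gt ((EReal.bot_lt_coe 0).trans_le (conjugate_nonneg hφ₀ Z)))

theorem pairing_le_of_mem (hφ₀ : IsLebesgueMonotoneConvex P φ₀) {Z : Lp ℝ 1 P}
    (hZ : Z ∈ conjugateDom P φ₀) (X : Lp ℝ ∞ P) :
    pairing P X Z ≤ φ₀ X + (conjugate P φ₀ Z).toReal :=
  conjugate_le_coe_iff.1 (coe_toReal_conjugate hφ₀ hZ).ge X

theorem mem_conjugateDom_of_pairing_le {Z : Lp ℝ 1 P} {c : ℝ}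
    (h : ∀ X, pairing P X Z ≤ φ₀ X + c) : Z ∈ conjugateDom P φ₀ :=
  (conjugate_le_coe_iff.2 h).trans_lt (EReal.coe_lt_top c)

theorem toReal_conjugate_nonneg (hφ₀ : IsLebesgueMonotoneConvex P φ₀) (Z : Lp ℝ 1 P) :
    0 ≤ (conjugate P φ₀ Z).toReal :=
  EReal.toReal_nonneg (conjugate_nonneg hφ₀ Z)

/-! ### Representation of functionals by integrable densities -/

variable [IsFiniteMeasure P]

theorem norm_Lp_top_le_of_ae {X : Lp ℝ ∞ P} {C : ℝ} (hC : 0 ≤ C) (h : ∀ᵐ ω ∂P, ‖X ω‖ ≤ C) :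
    ‖X‖ ≤ C := by
  simpa using Lp.norm_le_of_ae_bound hC h

/-- The indicator of a measurable set as an element of `L^∞`. -/
noncomputable def indicatorTop (P : Measure Ω) [IsFiniteMeasure P] {A : Set Ω}
    (hA : MeasurableSet A) : Lp ℝ ∞ P :=
  indicatorConstLp ∞ hA (measure_ne_top P A) 1

theorem coeFn_indicatorTop {A : Set Ω} (hA : MeasurableSet A) :
    ⇑(indicatorTop P hA) =ᵐ[P] A.indicator fun _ => 1 :=
  indicatorConstLp_coeFn

theorem indicatorTop_congr {A B : Set Ω} (hA : MeasurableSet A) (hB : MeasurableSet B)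
    (h : A = B) : indicatorTop P hA = indicatorTop P hB := by
  subst h
  rfl

theorem pairing_indicatorTop {A : Set Ω} (hA : MeasurableSet A) (Z : Lp ℝ 1 P) :
    pairing P (indicatorTop P hA) Z = ∫ ω in A, Z ω ∂P := by
  rw [pairing_apply, ← integral_indicator hA]
  refine integral_congr_ae ?_
  filter_upwards [coeFn_indicatorTop (P := P) hA] with ω h
  rw [h]
  by_cases hω : ω ∈ A <;> simp [hω]

theorem indicatorTop_nonneg {A : Set Ω} (hA : MeasurableSet A) : 0 ≤ indicatorTop P hA := by
  rw [← Lp.coeFn_nonneg]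
  filter_upwards [coeFn_indicatorTop (P := P) hA] with ω h
  rw [h]
  exact Set.indicator_nonneg (fun _ _ => zero_le_one) ω

theorem indicatorTop_union {A B : Set Ω} (hA : MeasurableSet A) (hB : MeasurableSet B)
    (h : Disjoint A B) :
    indicatorTop P (hA.union hB) = indicatorTop P hA + indicatorTop P hB := by
  refine Lp.ext ?_
  filter_upwards [coeFn_indicatorTop (P := P) hA, coeFn_indicatorTop (P := P) hB,
    coeFn_indicatorTop (P := P) (hA.union hB),
    Lp.coeFn_add (indicatorTop P hA) (indicatorTop P hB)] with ω h1 h2 h3 h4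
  rw [h3, h4, Pi.add_apply, h1, h2, Set.indicator_union_of_disjoint h]

theorem boundedTendstoZero_indicatorTop {A : ℕ → Set Ω} (hA : ∀ n, MeasurableSet (A n))
    (h : ∀ ω, ∀ᶠ n in atTop, ω ∉ A n) : BoundedTendstoZero fun n => indicatorTop P (hA n) := by
  refine ⟨⟨1, fun n => norm_Lp_top_le_of_ae zero_le_one ?_⟩, ?_⟩
  · filter_upwards [coeFn_indicatorTop (P := P) (hA n)] with ω hω
    rw [hω]
    exact (norm_indicator_le_norm_self _ _).trans (by simp)
  · filter_upwards [ae_all_iff.2 fun n => coeFn_indicatorTop (P := P) (hA n)] with ω hω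
    refine tendsto_const_nhds.congr' ?_
    filter_upwards [h ω] with n hn
    rw [hω, Set.indicator_of_notMem hn]

/-- A linear functional on `L^∞` that is continuous for bounded a.s. convergence restricts to a
countably additive set function. -/
theorem hasSum_indicatorTop {l : Lp ℝ ∞ P →L[ℝ] ℝ}
    (hl : ∀ X, BoundedTendstoZero X → Tendsto (fun n => l (X n)) atTop (𝓝 0))
    {A : ℕ → Set Ω} (hA : ∀ n, MeasurableSet (A n)) (hd : Pairwise (Function.onFun Disjoint A)) :
    HasSum (fun i => l (indicatorTop P (hA i))) (l (indicatorTop P (MeasurableSet.iUnion hA))) := by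
  have hm : ∀ s : Finset ℕ, MeasurableSet (⋃ i ∈ s, A i) := fun s =>
    s.measurableSet_biUnion fun i _ => hA i
  have hm' : ∀ s : Finset ℕ, MeasurableSet ((⋃ i, A i) \ ⋃ i ∈ s, A i) := fun s =>
    (MeasurableSet.iUnion hA).diff (hm s)
  have hfin : ∀ s : Finset ℕ,
      ∑ i ∈ s, l (indicatorTop P (hA i)) = l (indicatorTop P (hm s)) := by
    intro s
    induction s using Finset.cons_induction with
    | empty =>
      have : indicatorTop P (hm ∅) = 0 := by
        rw [indicatorTop_congr (hm ∅) MeasurableSet.empty (by simp)]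
        exact indicatorConstLp_empty
      rw [this, map_zero, Finset.sum_empty]
    | cons a s ha ih =>
      rw [Finset.sum_cons, ih, ← map_add, ← indicatorTop_union (hA a) (hm s)]
      · congr 1
        exact indicatorTop_congr _ _ (by simp)
      · rw [Set.disjoint_iUnion₂_right]
        rintro i hi
        exact hd fun h => ha (h ▸ hi)
  have hsplit : ∀ s : Finset ℕ, ∑ i ∈ s, l (indicatorTop P (hA i)) =
      l (indicatorTop P (MeasurableSet.iUnion hA)) - l (indicatorTop P (hm' s)) := by
    intro s
    rw [hfin, eq_sub_iff_add_eq, ← map_add, ← indicatorTop_union (hm s) (hm' s)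
      Set.disjoint_sdiff_right]
    congr 1
    refine indicatorTop_congr _ _ (Set.union_sdiff_cancel ?_)
    exact Set.iUnion₂_subset fun i _ => Set.subset_iUnion A i
  have hgoal : Tendsto (fun s : Finset ℕ => ∑ i ∈ s, l (indicatorTop P (hA i))) atTop
      (𝓝 (l (indicatorTop P (MeasurableSet.iUnion hA)))) := by
    refine tendsto_of_seq_tendsto fun s hs => ?_
    simp only [Function.comp_def, hsplit]
    have h0 := hl _ (boundedTendstoZero_indicatorTop (P := P) (fun n => hm' (s n)) fun ω => ?_)
    · simpa using tendsto_const_nhds.sub h0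
    · by_cases hω : ω ∈ ⋃ i, A i
      · obtain ⟨i, hi⟩ := Set.mem_iUnion.1 hω
        filter_upwards [hs.eventually_ge_atTop {i}] with n hn
        simp only [Set.mem_sdiff, not_and, not_not]
        exact fun _ => Set.mem_iUnion₂.2 ⟨i, Finset.singleton_subset_iff.1 hn, hi⟩
      · exact Eventually.of_forall fun n h => hω h.1
  simpa [HasSum] using hgoal

theorem indicatorTop_eq_zero {A : Set Ω} (hA : MeasurableSet A) (h : P A = 0) :
    indicatorTop P hA = 0 := by
  refine Lp.ext ?_
  filter_upwards [coeFn_indicatorTop (P := P) hA, Lp.coeFn_zero ℝ ∞ P,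
    measure_eq_zero_iff_ae_notMem.1 h] with ω h1 h2 h3
  rw [h1, h2, Set.indicator_of_notMem h3]
  rfl

open scoped Classical in
/-- A linear functional on `L^∞` that is continuous for bounded a.s. convergence is integration
against an integrable density. -/
theorem exists_density {l : Lp ℝ ∞ P →L[ℝ] ℝ}
    (hl : ∀ X, BoundedTendstoZero X → Tendsto (fun n => l (X n)) atTop (𝓝 0)) :
    ∃ Z : Lp ℝ 1 P, ∀ X, l X = pairing P X Z := by
  let s : SignedMeasure Ω :=
    { measureOf' := fun A => if hA : MeasurableSet A then l (indicatorTop P hA) else 0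
      empty' := by
        rw [dif_pos MeasurableSet.empty, indicatorTop_eq_zero _ measure_empty, map_zero]
      not_measurable' := fun A hA => dif_neg hA
      m_iUnion' := fun A hA hd => by
        rw [dif_pos (MeasurableSet.iUnion hA)]
        simp only [dif_pos (hA _)]
        exact hasSum_indicatorTop hl hA hd }
  have hs : ∀ {A : Set Ω} (hA : MeasurableSet A), s A = l (indicatorTop P hA) :=
    fun hA => dif_pos hA
  have hac : s ≪ᵥ P.toENNRealVectorMeasure := by
    refine VectorMeasure.AbsolutelyContinuous.mk fun A hA h0 => ?_
    rw [Measure.toENNRealVectorMeasure_apply_measurable hA] at h0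
    rw [hs hA, indicatorTop_eq_zero hA h0, map_zero]
  have hint := SignedMeasure.integrable_rnDeriv s P
  refine ⟨hint.toL1, fun X => ?_⟩
  set Z := hint.toL1
  have hind : ∀ {A : Set Ω} (hA : MeasurableSet A),
      l (indicatorTop P hA) = pairing P (indicatorTop P hA) Z := by
    intro A hA
    rw [pairing_indicatorTop, ← hs hA, ← SignedMeasure.withDensityᵥ_rnDeriv_eq s P hac,
      withDensityᵥ_apply (SignedMeasure.integrable_rnDeriv _ _) hA]
    exact setIntegral_congr_ae hA (hint.coeFn_toL1.mono fun ω h _ => h.symm)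
  have hmem : ∀ f : SimpleFunc Ω ℝ, MemLp f ∞ P := fun f => f.memLp_top P
  have hsimple : ∀ f : SimpleFunc Ω ℝ, l ((hmem f).toLp f) = pairing P ((hmem f).toLp f) Z := by
    intro f
    induction f using SimpleFunc.induction with
    | @const c A hA =>
      have heq : (hmem (SimpleFunc.piecewise A hA (SimpleFunc.const Ω c)
          (SimpleFunc.const Ω 0))).toLp _ = c • indicatorTop P hA := by
        refine Lp.ext ?_
        filter_upwards [coeFn_indicatorTop (P := P) hA, Lp.coeFn_smul c (indicatorTop P hA),
          (hmem (SimpleFunc.piecewise A hA (SimpleFunc.const Ω c)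
            (SimpleFunc.const Ω 0))).coeFn_toLp] with ω h1 h2 h3
        rw [h3, h2, Pi.smul_apply, h1]
        by_cases hω : ω ∈ A <;> simp [hω]
      rw [heq, map_smul, map_smul, hind hA]
      rfl
    | @add f g _ hf hg =>
      have heq : (hmem (f + g)).toLp _ = (hmem f).toLp f + (hmem g).toLp g := rfl
      rw [heq, map_add, map_add, hf, hg]
      rfl
  -- both sides are continuous for bounded a.s. convergence, for which simple functions are dense
  have hX := Lp.stronglyMeasurable X
  set F : ℕ → SimpleFunc Ω ℝ := hX.approxBounded ‖X‖
  have hbdd : BoundedTendstoZero fun n => X - (hmem (F n)).toLp (F n) := by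
    refine ⟨⟨‖X‖ + ‖X‖, fun n => ?_⟩, ?_⟩
    · refine (norm_sub_le _ _).trans (add_le_add le_rfl (norm_Lp_top_le_of_ae (norm_nonneg X) ?_))
      filter_upwards [(hmem (F n)).coeFn_toLp] with ω h
      rw [h]
      exact hX.norm_approxBounded_le (norm_nonneg X) n ω
    · filter_upwards [hX.tendsto_approxBounded_ae (ae_norm_le_norm_Lp_top X),
        ae_all_iff.2 fun n => (hmem (F n)).coeFn_toLp,
        ae_all_iff.2 fun n => Lp.coeFn_sub X ((hmem (F n)).toLp (F n))] with ω h1 h2 h3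
      simp only [h3, Pi.sub_apply, h2]
      simpa using (tendsto_const_nhds (x := X ω)).sub h1
  have h1 := hl _ hbdd
  have h2 := pairing_tendsto_zero Z hbdd
  simp only [map_sub, hsimple, _root_.sub_apply] at h1 h2
  have h3 := h1.sub h2
  simp only [sub_sub_sub_cancel_right, sub_zero] at h3
  exact sub_eq_zero.1 (tendsto_nhds_unique tendsto_const_nhds h3)

/-! ### The effective domain of the conjugate -/

/-- The dual representation of `φ₀`, by the Hahn–Banach theorem: up to any error, `φ₀ X` is of the
form `E[XZ] - φ₀^*(Z)`. -/
theorem exists_conjugate_le (hφ₀ : IsLebesgueMonotoneConvex P φ₀) (X : Lp ℝ ∞ P) {a : ℝ}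
    (ha : a < φ₀ X) : ∃ Z, conjugate P φ₀ Z ≤ ((pairing P X Z - a : ℝ) : EReal) := by
  obtain ⟨l, c, hl, hla⟩ := hφ₀.convex.exists_affine_le_of_lt (𝕜 := ℝ) (Set.mem_univ X) ha
    isClosed_univ (hφ₀.continuous.lowerSemicontinuous.lowerSemicontinuousOn _)
  have hl' : ∀ Y, l Y + c ≤ φ₀ Y := fun Y => hl ⟨Y, Set.mem_univ Y⟩
  obtain ⟨Z, hZ⟩ := exists_density fun Y hY => tendsto_zero_of_affine_le hφ₀ hl' hY
  refine ⟨Z, conjugate_le_coe_iff.2 fun Y => ?_⟩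
  have h := hl' Y
  rw [RCLike.re_to_real] at hla
  rw [← hZ, ← hZ]
  linarith

/-- By monotonicity of `φ₀`, the elements of `dom φ₀^*` are nonnegative: otherwise `E[XZ] - φ₀(X)`
would be unbounded along the multiples of a nonpositive indicator. -/
theorem ae_nonneg_of_mem (hφ₀ : IsLebesgueMonotoneConvex P φ₀) {Z : Lp ℝ 1 P}
    (hZ : Z ∈ conjugateDom P φ₀) : ∀ᵐ ω ∂P, 0 ≤ Z ω := by
  refine ae_nonneg_of_forall_setIntegral_nonneg (L1.integrable_coeFn Z) fun A hA _ => ?_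
  by_contra! hneg
  rw [← pairing_indicatorTop hA] at hneg
  set p := pairing P (indicatorTop P hA) Z
  have hc := toReal_conjugate_nonneg hφ₀ Z
  set c := (conjugate P φ₀ Z).toReal
  obtain ⟨n, hn⟩ := exists_nat_gt (c / (-p))
  rw [div_lt_iff₀ (by linarith)] at hn
  have h := pairing_le_of_mem hφ₀ hZ (-((n : ℝ) • indicatorTop P hA))
  have hmono : φ₀ (-((n : ℝ) • indicatorTop P hA)) ≤ φ₀ 0 :=
    hφ₀.monotone (neg_nonpos.2 (Lp_smul_nonneg n.cast_nonneg (indicatorTop_nonneg hA)))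
  rw [hφ₀.map_zero] at hmono
  rw [map_neg, map_smul, _root_.neg_apply, _root_.smul_apply, smul_eq_mul] at h
  linarith

theorem conjugateDom_nonempty (hφ₀ : IsLebesgueMonotoneConvex P φ₀) :
    (conjugateDom P φ₀).Nonempty := by
  obtain ⟨Z, hZ⟩ := exists_conjugate_le hφ₀ 0 (a := -1) (by rw [hφ₀.map_zero]; norm_num)
  exact ⟨Z, hZ.trans_lt (EReal.coe_lt_top _)⟩

/-- If `φ₀` is not identically `0`, then neither is `dom φ₀^*`: if `0` were its only element, then
`φ₀` would be the constant `- φ₀^*(0)`. -/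
theorem exists_mem_ne_zero (hφ₀ : IsLebesgueMonotoneConvex P φ₀) (hne : ∃ X, φ₀ X ≠ 0) :
    ∃ Z ∈ conjugateDom P φ₀, Z ≠ 0 := by
  by_contra! h
  have key : ∀ X Y, φ₀ X ≤ φ₀ Y := by
    intro X Y
    refine le_of_forall_lt fun a ha => ?_
    obtain ⟨b, hab, hb⟩ := exists_between ha
    obtain ⟨Z, hZ⟩ := exists_conjugate_le hφ₀ X hb
    have h0 := h Z (hZ.trans_lt (EReal.coe_lt_top _))
    have := conjugate_le_coe_iff.1 hZ Y
    rw [h0, map_zero, map_zero] at this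
    linarith
  obtain ⟨X, hX⟩ := hne
  exact hX ((le_antisymm (key X 0) (key 0 X)).trans hφ₀.map_zero)

/-! ### Elements of maximal support -/

/-- `dom φ₀^*` is stable under countable convex combinations with suitable weights, so countably
many supports are contained in a single one. -/
theorem exists_mem_support_ge (hφ₀ : IsLebesgueMonotoneConvex P φ₀) (Z : ℕ → Lp ℝ 1 P)
    (hZ : ∀ n, Z n ∈ conjugateDom P φ₀) :
    ∃ Z' ∈ conjugateDom P φ₀, ∀ n, ∀ᵐ ω ∂P, 0 < Z n ω → 0 < Z' ω := by
  set c : ℕ → ℝ := fun n => (conjugate P φ₀ (Z n)).toReal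
  have hc : ∀ n, 0 ≤ c n := fun n => toReal_conjugate_nonneg hφ₀ (Z n)
  -- unnormalized weights that make `u`, `u * c` and `u * ‖Z‖` summable
  set u : ℕ → ℝ := fun n => (1 / 2 : ℝ) ^ n / (1 + c n + ‖Z n‖) with hu
  have hden : ∀ n, 0 < 1 + c n + ‖Z n‖ := fun n => by
    have := hc n
    positivity
  have hupos : ∀ n, 0 < u n := fun n => div_pos (by positivity) (hden n)
  have hgeom : Summable fun n : ℕ => (1 / 2 : ℝ) ^ n := summable_geometric_two
  have hbound : ∀ (x : ℕ → ℝ), (∀ n, 0 ≤ x n) → (∀ n, x n ≤ 1 + c n + ‖Z n‖) →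
      Summable fun n => u n * x n := by
    intro x hx0 hx
    refine Summable.of_nonneg_of_le (fun n => mul_nonneg (hupos n).le (hx0 n)) (fun n => ?_) hgeom
    rw [hu]
    simp only
    rw [div_mul_eq_mul_div, div_le_iff₀ (hden n)]
    exact mul_le_mul_of_nonneg_left (hx n) (by positivity)
  have hsu : Summable u := by
    simpa using hbound (fun _ => 1) (fun _ => zero_le_one) fun n => by
      have := hc n
      have := norm_nonneg (Z n)
      linarith
  have hsc : Summable fun n => u n * c n := hbound c hc fun n => by
    have := norm_nonneg (Z n)
    linarith
  have hsZ : Summable fun n => u n • Z n := by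
    refine Summable.of_norm ?_
    refine (hbound (fun n => ‖Z n‖) (fun n => norm_nonneg _) fun n => ?_).congr fun n => ?_
    · have := hc n
      linarith
    · rw [_root_.norm_smul, Real.norm_of_nonneg (hupos n).le]
  set U : ℝ := ∑' n, u n
  have hU : 0 < U := hsu.tsum_pos (fun n => (hupos n).le) 0 (hupos 0)
  set S : Lp ℝ 1 P := ∑' n, u n • Z n with hS
  refine ⟨U⁻¹ • S, mem_conjugateDom_of_pairing_le (c := U⁻¹ * ∑' n, u n * c n) fun X => ?_,
    fun n => ?_⟩
  · have h1 : pairing P X S = ∑' n, u n * pairing P X (Z n) := by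
      rw [hS, (pairing P X).map_tsum hsZ]
      simp
    have h2 : Summable fun n => u n * pairing P X (Z n) := by
      simpa using hsZ.mapL (pairing P X)
    have h3 : ∑' n, u n * pairing P X (Z n) ≤ ∑' n, (u n * φ₀ X + u n * c n) :=
      h2.tsum_le_tsum (fun n => by
        rw [← mul_add]
        exact mul_le_mul_of_nonneg_left (pairing_le_of_mem hφ₀ (hZ n) X) (hupos n).le)
        ((hsu.mul_right _).add hsc)
    rw [(hsu.mul_right _).tsum_add hsc, tsum_mul_right] at h3
    rw [map_smul, smul_eq_mul, h1]
    calc U⁻¹ * ∑' n, u n * pairing P X (Z n) ≤ U⁻¹ * (U * φ₀ X + ∑' n, u n * c n) :=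
          mul_le_mul_of_nonneg_left h3 (inv_nonneg.2 hU.le)
      _ = φ₀ X + U⁻¹ * ∑' n, u n * c n := by
          rw [mul_add, inv_mul_cancel_left₀ hU.ne']
  · have hnn : ∀ m, 0 ≤ u m • Z m := fun m =>
      Lp_smul_nonneg (hupos m).le ((Lp.coeFn_nonneg _).1 (ae_nonneg_of_mem hφ₀ (hZ m)))
    have hle : u n • Z n ≤ S := hsZ.le_tsum n fun m _ => hnn m
    filter_upwards [(Lp.coeFn_le _ _).2 hle, Lp.coeFn_smul (u n) (Z n),
      Lp.coeFn_smul U⁻¹ S] with ω h1 h2 h3 h4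
    rw [h2] at h1
    rw [h3]
    have h5 : 0 < u n * Z n ω := mul_pos (hupos n) h4
    exact mul_pos (inv_pos.2 hU) (h5.trans_le h1)

theorem ae_zero_iff_setIntegral (hφ₀ : IsLebesgueMonotoneConvex P φ₀) {Z : Lp ℝ 1 P}
    (hZ : Z ∈ conjugateDom P φ₀) {A : Set Ω} (hA : MeasurableSet A) :
    ∫ ω in A, Z ω ∂P = 0 ↔ ∀ᵐ ω ∂P, ω ∈ A → Z ω = 0 := by
  rw [setIntegral_eq_zero_iff_of_nonneg_ae (ae_restrict_of_ae (ae_nonneg_of_mem hφ₀ hZ))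
    (L1.integrable_coeFn Z).integrableOn]
  exact ae_restrict_iff' hA

/-- Exhaustion: an element of `dom φ₀^*` whose support has the largest probability has maximal
support. -/
theorem exists_isMaximalSupport (hφ₀ : IsLebesgueMonotoneConvex P φ₀) :
    ∃ Z : Lp ℝ 1 P, IsMaximalSupport P φ₀ Z := by
  obtain ⟨t, -, htlim, htmem⟩ := exists_seq_tendsto_sSup
    ((conjugateDom_nonempty hφ₀).image fun Z : Lp ℝ 1 P => P {ω | 0 < Z ω})
    (OrderTop.bddAbove _)
  choose Z hZ hZt using htmem
  obtain ⟨Z', hZ', hsupp⟩ := exists_mem_support_ge hφ₀ Z hZ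
  have hmax : ∀ W ∈ conjugateDom P φ₀, P {ω | 0 < W ω} ≤ P {ω | 0 < Z' ω} := by
    intro W hW
    refine (le_sSup (Set.mem_image_of_mem (fun Z : Lp ℝ 1 P => P {ω | 0 < Z ω}) hW)).trans ?_
    refine le_of_tendsto' htlim fun n => ?_
    rw [← hZt n]
    exact measure_mono_ae (hsupp n)
  refine ⟨Z', hZ', fun A hA h0 W hW => ?_⟩
  -- the support of `V` contains those of `Z'` and `W`
  obtain ⟨V, hV, hVsupp⟩ := exists_mem_support_ge hφ₀ (fun n => if n = 0 then Z' else W)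
    fun n => by
      split_ifs
      · exact hZ'
      · exact hW
  have hV0 : ∀ᵐ ω ∂P, 0 < Z' ω → 0 < V ω := by simpa using hVsupp 0
  have hV1 : ∀ᵐ ω ∂P, 0 < W ω → 0 < V ω := by simpa using hVsupp 1
  have hmeas : MeasurableSet {ω | 0 < Z' ω} :=
    measurableSet_lt measurable_const (Lp.stronglyMeasurable Z').measurable
  have heq : ({ω | 0 < Z' ω} : Set Ω) =ᵐ[P] {ω | 0 < V ω} :=
    ae_eq_of_ae_subset_of_measure_ge hV0 (hmax V hV) hmeas.nullMeasurableSet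
      (measure_ne_top P _)
  rw [ae_zero_iff_setIntegral hφ₀ hZ' hA] at h0
  rw [ae_zero_iff_setIntegral hφ₀ hW hA]
  filter_upwards [h0, hV1, heq.le, heq.symm.le, ae_nonneg_of_mem hφ₀ hW] with ω h1 h2 _ h4 h5 hω
  by_contra hne
  have h6 : 0 < Z' ω := h4 (h2 (lt_of_le_of_ne h5 (Ne.symm hne)))
  exact h6.ne' (h1 hω)

end Duality

/-! ### The gauge as a supremum of integrals -/

section Gauge

variable {P : Measure Ω} {φ₀ : Lp ℝ ∞ P → ℝ}

/-- The measure `Z dP`, for `Z ≥ 0` in `L^1(P)`. -/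
noncomputable def densityMeasure (P : Measure Ω) (Z : Lp ℝ 1 P) : Measure Ω :=
  P.withDensity fun ω => ENNReal.ofReal (Z ω)

/-- The penalty `φ₀^*(Z)` as an element of `[0, ∞]`. -/
noncomputable def penalty (P : Measure Ω) (φ₀ : Lp ℝ ∞ P → ℝ) (Z : Lp ℝ 1 P) : ℝ≥0∞ :=
  (conjugate P φ₀ Z).toENNReal

/-- The measures `Z / (1 + φ₀^*(Z)) dP`, indexed by `Z ∈ dom φ₀^*`. The supremum of the integrals
against them is the gauge. -/
noncomputable def gaugeMeasure (P : Measure Ω) (φ₀ : Lp ℝ ∞ P → ℝ) (Z : conjugateDom P φ₀) :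
    Measure Ω :=
  (1 + penalty P φ₀ Z)⁻¹ • densityMeasure P (Z : Lp ℝ 1 P)

theorem coe_penalty (hφ₀ : IsLebesgueMonotoneConvex P φ₀) (Z : Lp ℝ 1 P) :
    (penalty P φ₀ Z : EReal) = conjugate P φ₀ Z :=
  EReal.coe_toENNReal (conjugate_nonneg hφ₀ Z)

theorem penalty_ne_top {Z : Lp ℝ 1 P} (hZ : Z ∈ conjugateDom P φ₀) : penalty P φ₀ Z ≠ ∞ :=
  EReal.toENNReal_ne_top_iff.2 (ne_of_lt hZ)

theorem measurable_ofReal_Lp (Z : Lp ℝ 1 P) : Measurable fun ω => ENNReal.ofReal (Z ω) :=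
  (Lp.stronglyMeasurable Z).measurable.ennreal_ofReal

theorem one_add_penalty_ne_top {Z : Lp ℝ 1 P} (hZ : Z ∈ conjugateDom P φ₀) :
    1 + penalty P φ₀ Z ≠ ∞ :=
  ENNReal.add_ne_top.2 ⟨ENNReal.one_ne_top, penalty_ne_top hZ⟩

theorem supLIntegral_gaugeMeasure_le_iff {f : Ω → ℝ≥0∞} {r : ℝ≥0∞} :
    supLIntegral (gaugeMeasure P φ₀) f ≤ r ↔ ∀ Z ∈ conjugateDom P φ₀,
      ∫⁻ ω, f ω ∂densityMeasure P Z ≤ (1 + penalty P φ₀ Z) * r := by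
  rw [supLIntegral, iSup_le_iff, Subtype.forall]
  refine forall₂_congr fun Z hZ => ?_
  rw [gaugeMeasure, lintegral_smul_measure, smul_eq_mul, mul_comm, ← div_eq_mul_inv,
    ENNReal.div_le_iff_le_mul (Or.inl (by simp)) (Or.inl (one_add_penalty_ne_top hZ)), mul_comm]

theorem measureQ_eq_smul {Z' : Lp ℝ 1 P} (hpos : 0 < ∫ ω, Z' ω ∂P) :
    measureQ P Z' = (ENNReal.ofReal (∫ ω, Z' ω ∂P))⁻¹ • densityMeasure P Z' := by
  rw [measureQ, densityMeasure, ← withDensity_smul _ (measurable_ofReal_Lp Z')]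
  congr 1
  funext ω
  rw [ENNReal.ofReal_div_of_pos hpos, Pi.smul_apply, smul_eq_mul, div_eq_mul_inv, mul_comm]

variable [IsFiniteMeasure P]

theorem extExpectation_mul (hφ₀ : IsLebesgueMonotoneConvex P φ₀) {Z : Lp ℝ 1 P}
    (hZ : Z ∈ conjugateDom P φ₀) {f : Ω → ℝ} (hf : Measurable f) (hf0 : ∀ ω, 0 ≤ f ω) :
    extExpectation P (fun ω => f ω * Z ω) =
      ((∫⁻ ω, ENNReal.ofReal (f ω) ∂densityMeasure P Z : ℝ≥0∞) : EReal) := by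
  have hneg : ∫⁻ ω, ENNReal.ofReal (-(f ω * Z ω)) ∂P = 0 := by
    rw [← lintegral_zero (μ := P)]
    refine lintegral_congr_ae ?_
    filter_upwards [ae_nonneg_of_mem hφ₀ hZ] with ω h
    exact ENNReal.ofReal_of_nonpos (neg_nonpos.2 (mul_nonneg (hf0 ω) h))
  rw [extExpectation, hneg, EReal.coe_ennreal_zero, sub_zero, densityMeasure,
    lintegral_withDensity_eq_lintegral_mul _ (measurable_ofReal_Lp Z) hf.ennreal_ofReal]
  congr 1
  refine lintegral_congr fun ω => ?_
  rw [ENNReal.ofReal_mul (hf0 ω), Pi.mul_apply, mul_comm]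

theorem phiHat_le_coe_iff (hφ₀ : IsLebesgueMonotoneConvex P φ₀) {f : Ω → ℝ} (hf : Measurable f)
    (hf0 : ∀ ω, 0 ≤ f ω) (t : ℝ≥0∞) :
    phiHat P φ₀ f ≤ t ↔ ∀ Z ∈ conjugateDom P φ₀,
      ∫⁻ ω, ENNReal.ofReal (f ω) ∂densityMeasure P Z ≤ t + penalty P φ₀ Z := by
  rw [phiHat, iSup₂_le_iff]
  refine forall₂_congr fun Z hZ => ?_
  rw [extExpectation_mul hφ₀ hZ hf hf0, ← coe_penalty hφ₀, EReal.sub_le_iff_le_add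
    (Or.inl (EReal.coe_ennreal_ne_bot _))
    (Or.inl (EReal.coe_ennreal_eq_top_iff.not.2 (penalty_ne_top hZ))),
    ← EReal.coe_ennreal_add, EReal.coe_ennreal_le_coe_ennreal_iff]

/-- At the level `1` the penalty `φ₀^*(Z)` is absorbed by the normalization of `Z`. -/
theorem phiHat_le_one_iff (hφ₀ : IsLebesgueMonotoneConvex P φ₀) {f : Ω → ℝ} (hf : Measurable f)
    (hf0 : ∀ ω, 0 ≤ f ω) : phiHat P φ₀ f ≤ 1 ↔
      supLIntegral (gaugeMeasure P φ₀) (fun ω => ENNReal.ofReal (f ω)) ≤ 1 := by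
  rw [← EReal.coe_ennreal_one, phiHat_le_coe_iff hφ₀ hf hf0, supLIntegral_gaugeMeasure_le_iff]
  simp only [mul_one]

theorem phiHat_le_of_supLIntegral_le (hφ₀ : IsLebesgueMonotoneConvex P φ₀) {f : Ω → ℝ}
    (hf : Measurable f) (hf0 : ∀ ω, 0 ≤ f ω) {t : ℝ≥0∞} (ht : t ≤ 1)
    (h : supLIntegral (gaugeMeasure P φ₀) (fun ω => ENNReal.ofReal (f ω)) ≤ t) :
    phiHat P φ₀ f ≤ t := by
  rw [phiHat_le_coe_iff hφ₀ hf hf0]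
  rw [supLIntegral_gaugeMeasure_le_iff] at h
  refine fun Z hZ => (h Z hZ).trans ?_
  rw [add_mul, one_mul]
  exact add_le_add le_rfl (mul_le_of_le_one_right' ht)

/-- `φ̂ ≥ 0` on nonnegative functions, because `inf φ₀^* = - φ₀ 0 = 0`. -/
theorem phiHat_nonneg (hφ₀ : IsLebesgueMonotoneConvex P φ₀) {f : Ω → ℝ} (hf : Measurable f)
    (hf0 : ∀ ω, 0 ≤ f ω) : 0 ≤ phiHat P φ₀ f := by
  refine le_of_forall_lt fun a ha => ?_
  obtain ⟨b, hab, hb⟩ := EReal.lt_iff_exists_real_btwn.1 ha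
  obtain ⟨Z, hZ⟩ := exists_conjugate_le hφ₀ 0 (a := b)
    (by rw [hφ₀.map_zero]; exact_mod_cast hb)
  rw [map_zero, _root_.zero_apply, zero_sub] at hZ
  have hZ' : Z ∈ conjugateDom P φ₀ := hZ.trans_lt (EReal.coe_lt_top _)
  refine hab.trans_le (le_trans ?_ (le_iSup₂ (f := fun Z (_ : Z ∈ conjugateDom P φ₀) =>
    extExpectation P (fun ω => f ω * Z ω) - conjugate P φ₀ Z) Z hZ'))
  rw [extExpectation_mul hφ₀ hZ' hf hf0]
  calc (b : EReal) = 0 - ((-b : ℝ) : EReal) := by simp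
    _ ≤ _ := EReal.sub_le_sub (EReal.coe_ennreal_nonneg _) hZ

theorem gaugeNorm_eq_supLIntegral (hφ₀ : IsLebesgueMonotoneConvex P φ₀) (X : Ω →ₘ[P] ℝ) :
    gaugeNorm P φ₀ X = supLIntegral (gaugeMeasure P φ₀) (fun ω => ‖X ω‖ₑ) := by
  set s := supLIntegral (gaugeMeasure P φ₀) (fun ω => ‖X ω‖ₑ) with hs
  have hiff : ∀ l : ℝ, 0 < l → (phiHat P φ₀ (fun ω => |X ω| / l) ≤ 1 ↔ s ≤ ENNReal.ofReal l) := by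
    intro l hl
    have hl0 : ENNReal.ofReal l ≠ 0 := (ENNReal.ofReal_pos.2 hl).ne'
    rw [phiHat_le_one_iff hφ₀ (X.measurable.abs.div_const l) fun ω => by positivity]
    have heq : (fun ω => ENNReal.ofReal (|X ω| / l)) =
        fun ω => (ENNReal.ofReal l)⁻¹ * ‖X ω‖ₑ := by
      funext ω
      rw [ENNReal.ofReal_div_of_pos hl, Real.enorm_eq_ofReal_abs, mul_comm, div_eq_mul_inv]
    rw [heq, supLIntegral_const_mul (ENNReal.inv_ne_top.2 hl0), ← hs, mul_comm, ← div_eq_mul_inv,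
      ENNReal.div_le_iff_le_mul (Or.inl hl0) (Or.inl ENNReal.ofReal_ne_top), one_mul]
  refine le_antisymm ?_ (le_iInf fun l => le_iInf fun hl => le_iInf fun h => (hiff l hl).1 h)
  refine le_of_forall_gt fun t ht => ?_
  obtain ⟨r, hsr, hrt⟩ := ENNReal.lt_iff_exists_nnreal_btwn.1 ht
  have hr : 0 < (r : ℝ) := by exact_mod_cast (zero_le.trans_lt hsr : (0 : ℝ≥0∞) < r)
  have hr' : ENNReal.ofReal (r : ℝ) = r := ENNReal.ofReal_coe_nnreal
  refine lt_of_le_of_lt (iInf_le_of_le (r : ℝ) (iInf_le_of_le hr (iInf_le _ ?_))) (hr' ▸ hrt)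
  exact (hiff r hr).2 (hr' ▸ hsr.le)

/-- `M_u^φ̂` consists of the functions that their truncations approximate for the gauge. -/
theorem mem_spaceMu_iff (hφ₀ : IsLebesgueMonotoneConvex P φ₀) (X : Ω →ₘ[P] ℝ) :
    X ∈ spaceMu P φ₀ ↔ ∀ ε : ℝ≥0∞, 0 < ε →
      ∃ K : NNReal, supLIntegral (gaugeMeasure P φ₀) (fun ω => ‖X ω‖ₑ - K) ≤ ε := by
  have hmeas : ∀ (α : ℝ) (N : ℕ),
      Measurable ({ω | (N : ℝ) < |X ω|}.indicator (fun ω => α * |X ω|)) := fun α N =>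
    (X.measurable.abs.const_mul α).indicator (measurableSet_lt measurable_const X.measurable.abs)
  have hnn : ∀ (α : ℝ), 0 < α → ∀ (N : ℕ) (ω : Ω),
      0 ≤ {ω | (N : ℝ) < |X ω|}.indicator (fun ω => α * |X ω|) ω := fun α hα N ω =>
    Set.indicator_nonneg (fun ω _ => by positivity) ω
  have hofReal : ∀ (α : ℝ), 0 < α → ∀ (N : ℕ) (ω : Ω),
      ENNReal.ofReal ({ω | (N : ℝ) < |X ω|}.indicator (fun ω => α * |X ω|) ω) =
        if (N : ℝ≥0∞) < ‖X ω‖ₑ then ENNReal.ofReal α * ‖X ω‖ₑ else 0 := by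
    intro α hα N ω
    have hiff : (N : ℝ≥0∞) < ‖X ω‖ₑ ↔ (N : ℝ) < |X ω| := by
      rw [Real.enorm_eq_ofReal_abs, ← ENNReal.ofReal_natCast,
        ENNReal.ofReal_lt_ofReal_iff_of_nonneg N.cast_nonneg]
    by_cases h : (N : ℝ) < |X ω|
    · rw [if_pos (hiff.2 h), Set.indicator_of_mem (by exact h), ENNReal.ofReal_mul hα.le,
        Real.enorm_eq_ofReal_abs]
    · rw [if_neg (mt hiff.1 h), Set.indicator_of_notMem (by exact h), ENNReal.ofReal_zero]
  constructor
  · intro hX ε hε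
    obtain ⟨r, hr0, hrε⟩ := ENNReal.lt_iff_exists_nnreal_btwn.1 hε
    have hr : 0 < (r : ℝ) := by exact_mod_cast hr0
    obtain ⟨N, hN⟩ := ((hX (r : ℝ)⁻¹ (inv_pos.2 hr)).eventually_lt_const
      (show (0 : EReal) < 1 by norm_num)).exists
    have h1 := (phiHat_le_one_iff hφ₀ (hmeas _ N) (hnn _ (inv_pos.2 hr) N)).1 hN.le
    refine ⟨N, ?_⟩
    calc supLIntegral (gaugeMeasure P φ₀) (fun ω => ‖X ω‖ₑ - ((N : NNReal) : ℝ≥0∞))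
        ≤ supLIntegral (gaugeMeasure P φ₀) (fun ω => r *
            ENNReal.ofReal ({ω | (N : ℝ) < |X ω|}.indicator (fun ω => (r : ℝ)⁻¹ * |X ω|) ω)) := by
          refine supLIntegral_mono fun ω => ?_
          rw [hofReal _ (inv_pos.2 hr)]
          split_ifs with h
          · rw [ENNReal.ofReal_inv_of_pos hr, ENNReal.ofReal_coe_nnreal,
              ENNReal.mul_inv_cancel_left hr0.ne' ENNReal.coe_ne_top]
            exact tsub_le_self
          · rw [mul_zero, nonpos_iff_eq_zero]
            exact tsub_eq_zero_of_le (by simpa using h)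
      _ = r * supLIntegral (gaugeMeasure P φ₀) (fun ω =>
            ENNReal.ofReal ({ω | (N : ℝ) < |X ω|}.indicator (fun ω => (r : ℝ)⁻¹ * |X ω|) ω)) :=
          supLIntegral_const_mul ENNReal.coe_ne_top
      _ ≤ r * 1 := by gcongr
      _ ≤ ε := by rw [mul_one]; exact hrε.le
  · intro h α hα
    have hα0 : ENNReal.ofReal α ≠ 0 := (ENNReal.ofReal_pos.2 hα).ne'
    have hα2 : ENNReal.ofReal α * 2 ≠ 0 := mul_ne_zero hα0 two_ne_zero
    have hα2' : ENNReal.ofReal α * 2 ≠ ∞ :=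
      ENNReal.mul_ne_top ENNReal.ofReal_ne_top ENNReal.ofNat_ne_top
    have key : ∀ t : ℝ≥0∞, 0 < t → t ≤ 1 → ∀ᶠ N : ℕ in atTop,
        phiHat P φ₀ ({ω | (N : ℝ) < |X ω|}.indicator (fun ω => α * |X ω|)) ≤ t := by
      intro t ht ht1
      obtain ⟨K, hK⟩ := h (t / (ENNReal.ofReal α * 2)) (ENNReal.div_pos ht.ne' hα2')
      obtain ⟨N₀, hN₀⟩ := exists_nat_ge (2 * K)
      filter_upwards [eventually_ge_atTop N₀] with N hN
      refine phiHat_le_of_supLIntegral_le hφ₀ (hmeas α N) (hnn α hα N) ht1 ?_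
      calc supLIntegral (gaugeMeasure P φ₀) (fun ω =>
              ENNReal.ofReal ({ω | (N : ℝ) < |X ω|}.indicator (fun ω => α * |X ω|) ω))
          ≤ supLIntegral (gaugeMeasure P φ₀) (fun ω =>
              ENNReal.ofReal α * 2 * (‖X ω‖ₑ - K)) := by
            refine supLIntegral_mono fun ω => ?_
            rw [hofReal α hα]
            split_ifs with hlt
            · rw [mul_assoc]
              refine mul_le_mul_right ?_ _
              -- above the level `2 K`, a function is at most twice its excess over `K`
              have h2K : (2 : ℝ≥0∞) * K ≤ ‖X ω‖ₑ := by
                refine le_trans ?_ hlt.le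
                exact_mod_cast hN₀.trans (Nat.cast_le.2 hN)
              rw [ENNReal.mul_sub fun _ _ => ENNReal.ofNat_ne_top]
              refine ENNReal.le_sub_of_add_le_left
                (ENNReal.mul_ne_top ENNReal.ofNat_ne_top ENNReal.coe_ne_top) ?_
              rw [two_mul ‖X ω‖ₑ]
              exact add_le_add h2K le_rfl
            · exact zero_le
        _ = ENNReal.ofReal α * 2 * supLIntegral (gaugeMeasure P φ₀) (fun ω => ‖X ω‖ₑ - K) :=
            supLIntegral_const_mul hα2'
        _ ≤ ENNReal.ofReal α * 2 * (t / (ENNReal.ofReal α * 2)) := by gcongr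
        _ = t := ENNReal.mul_div_cancel hα2 hα2'
    refine tendsto_order.2 ⟨fun a ha => Eventually.of_forall fun N =>
      ha.trans_le (phiHat_nonneg hφ₀ (hmeas α N) (hnn α hα N)), fun a ha => ?_⟩
    obtain ⟨b, hb0, hba⟩ := EReal.lt_iff_exists_real_btwn.1 ha
    have hb0' : 0 < b := by exact_mod_cast hb0
    filter_upwards [key (min (ENNReal.ofReal b) 1)
      (lt_min (ENNReal.ofReal_pos.2 hb0') one_pos) (min_le_right _ _)] with N hN
    refine lt_of_le_of_lt (hN.trans ?_) hba
    calc ((min (ENNReal.ofReal b) 1 : ℝ≥0∞) : EReal) ≤ ((ENNReal.ofReal b : ℝ≥0∞) : EReal) :=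
          EReal.coe_ennreal_le_coe_ennreal_iff.2 (min_le_left _ _)
      _ = b := by rw [EReal.coe_ennreal_ofReal, max_eq_left hb0'.le]

/-! ### The measure of a density of maximal support -/

variable {Z' : Lp ℝ 1 P}

theorem integral_pos_of_isMaximalSupport (hφ₀ : IsLebesgueMonotoneConvex P φ₀)
    (hne : ∃ X, φ₀ X ≠ 0) (hZ' : IsMaximalSupport P φ₀ Z') : 0 < ∫ ω, Z' ω ∂P := by
  refine lt_of_le_of_ne (integral_nonneg_of_ae (ae_nonneg_of_mem hφ₀ hZ'.1)) fun h0 => ?_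
  obtain ⟨Z, hZ, hZ0⟩ := exists_mem_ne_zero hφ₀ hne
  have h1 := hZ'.2 Set.univ MeasurableSet.univ (by rw [setIntegral_univ, ← h0]) Z hZ
  rw [ae_zero_iff_setIntegral hφ₀ hZ MeasurableSet.univ] at h1
  refine hZ0 (Lp.ext ?_)
  filter_upwards [h1, Lp.coeFn_zero ℝ 1 P] with ω h2 h3
  rw [h3]
  exact h2 (Set.mem_univ ω)

theorem isProbabilityMeasure_measureQ (hφ₀ : IsLebesgueMonotoneConvex P φ₀)
    (hne : ∃ X, φ₀ X ≠ 0) (hZ' : IsMaximalSupport P φ₀ Z') :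
    IsProbabilityMeasure (measureQ P Z') := by
  have hpos := integral_pos_of_isMaximalSupport hφ₀ hne hZ'
  refine ⟨?_⟩
  rw [measureQ_eq_smul hpos, Measure.smul_apply, densityMeasure,
    withDensity_apply _ MeasurableSet.univ, Measure.restrict_univ, smul_eq_mul,
    ← ofReal_integral_eq_lintegral_ofReal (L1.integrable_coeFn Z') (ae_nonneg_of_mem hφ₀ hZ'.1)]
  exact ENNReal.inv_mul_cancel (ENNReal.ofReal_pos.2 hpos).ne' ENNReal.ofReal_ne_top

theorem densityMeasure_apply_eq_zero_iff (hφ₀ : IsLebesgueMonotoneConvex P φ₀) {Z : Lp ℝ 1 P}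
    (hZ : Z ∈ conjugateDom P φ₀) {A : Set Ω} (hA : MeasurableSet A) :
    densityMeasure P Z A = 0 ↔ ∫ ω in A, Z ω ∂P = 0 := by
  have hnn := ae_restrict_of_ae (s := A) (ae_nonneg_of_mem hφ₀ hZ)
  rw [densityMeasure, withDensity_apply _ hA, ← ofReal_integral_eq_lintegral_ofReal
    (L1.integrable_coeFn Z).integrableOn hnn, ENNReal.ofReal_eq_zero]
  exact ⟨fun h => le_antisymm h (integral_nonneg_of_ae hnn), fun h => h.le⟩

theorem densityMeasure_absolutelyContinuous (hφ₀ : IsLebesgueMonotoneConvex P φ₀)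
    (hne : ∃ X, φ₀ X ≠ 0) (hZ' : IsMaximalSupport P φ₀ Z') {Z : Lp ℝ 1 P}
    (hZ : Z ∈ conjugateDom P φ₀) : densityMeasure P Z ≪ measureQ P Z' := by
  have hpos := integral_pos_of_isMaximalSupport hφ₀ hne hZ'
  refine Measure.AbsolutelyContinuous.mk fun A hA h0 => ?_
  rw [measureQ_eq_smul hpos, Measure.smul_apply, smul_eq_mul, mul_eq_zero, ENNReal.inv_eq_zero,
    or_iff_right ENNReal.ofReal_ne_top, densityMeasure_apply_eq_zero_iff hφ₀ hZ'.1 hA] at h0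
  exact (densityMeasure_apply_eq_zero_iff hφ₀ hZ hA).2 (hZ'.2 A hA h0 Z hZ)

theorem gaugeMeasure_absolutelyContinuous (hφ₀ : IsLebesgueMonotoneConvex P φ₀)
    (hne : ∃ X, φ₀ X ≠ 0) (hZ' : IsMaximalSupport P φ₀ Z') (Z : conjugateDom P φ₀) :
    gaugeMeasure P φ₀ Z ≪ measureQ P Z' :=
  (densityMeasure_absolutelyContinuous hφ₀ hne hZ' Z.2).smul_left _

theorem lintegral_measureQ_le (hφ₀ : IsLebesgueMonotoneConvex P φ₀) (hne : ∃ X, φ₀ X ≠ 0)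
    (hZ' : IsMaximalSupport P φ₀ Z') (f : Ω → ℝ≥0∞) :
    ∫⁻ ω, f ω ∂measureQ P Z' ≤ (ENNReal.ofReal (∫ ω, Z' ω ∂P))⁻¹ * (1 + penalty P φ₀ Z') *
      supLIntegral (gaugeMeasure P φ₀) f := by
  rw [measureQ_eq_smul (integral_pos_of_isMaximalSupport hφ₀ hne hZ'), lintegral_smul_measure,
    smul_eq_mul, mul_assoc]
  exact mul_le_mul_right (supLIntegral_gaugeMeasure_le_iff.1 le_rfl Z' hZ'.1) _

theorem lintegral_densityMeasure_eq_pairing (hφ₀ : IsLebesgueMonotoneConvex P φ₀) {Z : Lp ℝ 1 P}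
    (hZ : Z ∈ conjugateDom P φ₀) {g : Ω → ℝ} (hg : Measurable g) (hg0 : ∀ ω, 0 ≤ g ω)
    (hmem : MemLp g ∞ P) :
    ∫⁻ ω, ENNReal.ofReal (g ω) ∂densityMeasure P Z =
      ENNReal.ofReal (pairing P (hmem.toLp g) Z) := by
  have hint : ∫ ω, hmem.toLp g ω * Z ω ∂P = ∫ ω, g ω * Z ω ∂P :=
    integral_congr_ae (hmem.coeFn_toLp.mono fun ω h => by simp only [h])
  have hprod : Integrable (fun ω => g ω * Z ω) P :=
    memLp_one_iff_integrable.1 ((Lp.memLp Z).mul hmem)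
  rw [pairing_apply, hint, ofReal_integral_eq_lintegral_ofReal hprod, densityMeasure,
    lintegral_withDensity_eq_lintegral_mul _ (measurable_ofReal_Lp Z) hg.ennreal_ofReal]
  · refine lintegral_congr fun ω => ?_
    rw [ENNReal.ofReal_mul (hg0 ω), Pi.mul_apply, mul_comm]
  · filter_upwards [ae_nonneg_of_mem hφ₀ hZ] with ω h
    exact mul_nonneg (hg0 ω) h

/-- The gauge inherits the Lebesgue property of `φ₀`, because `E[XZ] ≤ φ₀ X + φ₀^*(Z)` for bounded
`X`. Convergence `Q`-a.s. becomes convergence `P`-a.s. after multiplication with the indicator of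
the support of `Z'`, which changes no integral against an element of `dom φ₀^*`. -/
theorem hasLebesgueProperty_gaugeMeasure (hφ₀ : IsLebesgueMonotoneConvex P φ₀)
    (hne : ∃ X, φ₀ X ≠ 0) (hZ' : IsMaximalSupport P φ₀ Z') :
    HasLebesgueProperty (gaugeMeasure P φ₀) (measureQ P Z') := by
  intro f C hf hfC hlim
  have hpos := integral_pos_of_isMaximalSupport hφ₀ hne hZ'
  have hdens : Measurable fun ω => ENNReal.ofReal (Z' ω / ∫ ω', Z' ω' ∂P) :=
    ((Lp.stronglyMeasurable Z').measurable.div_const _).ennreal_ofReal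
  set S : Set Ω := {ω | 0 < Z' ω}
  have hSmeas : MeasurableSet S :=
    measurableSet_lt measurable_const (Lp.stronglyMeasurable Z').measurable
  have hiff : ∀ ω, ENNReal.ofReal (Z' ω / ∫ ω', Z' ω' ∂P) ≠ 0 ↔ ω ∈ S := fun ω => by
    rw [← pos_iff_ne_zero, ENNReal.ofReal_pos, div_pos_iff_of_pos_right hpos]
    rfl
  have hSQ : ∀ᵐ ω ∂measureQ P Z', ω ∈ S := by
    rw [measureQ, ae_withDensity_iff hdens]
    exact Eventually.of_forall fun ω h => (hiff ω).1 h
  rw [measureQ, ae_withDensity_iff hdens] at hlim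
  refine ENNReal.tendsto_nhds_zero.2 fun ε hε => ?_
  obtain ⟨r, hr0, hrε⟩ := ENNReal.lt_iff_exists_nnreal_btwn.1 hε
  have hr : 0 < (r : ℝ) := by exact_mod_cast hr0
  set g : ℕ → Ω → ℝ := fun n => S.indicator fun ω => (f n ω).toReal with hgdef
  have hg : ∀ n, Measurable (g n) := fun n => (hf n).ennreal_toReal.indicator hSmeas
  have hg0 : ∀ n ω, 0 ≤ g n ω := fun n ω =>
    Set.indicator_nonneg (fun _ _ => ENNReal.toReal_nonneg) ω
  have hgC : ∀ n ω, ‖g n ω‖ ≤ C := fun n ω => by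
    refine (norm_indicator_le_norm_self _ _).trans ?_
    rw [Real.norm_of_nonneg ENNReal.toReal_nonneg]
    exact ENNReal.toReal_mono ENNReal.coe_ne_top (hfC n ω)
  have hmem : ∀ n, MemLp (g n) ∞ P := fun n =>
    memLp_top_of_bound (hg n).aestronglyMeasurable C (Eventually.of_forall (hgC n))
  have hbdd : BoundedTendstoZero fun n => (hmem n).toLp (g n) := by
    refine ⟨⟨C, fun n => norm_Lp_top_le_of_ae C.coe_nonneg ?_⟩, ?_⟩
    · filter_upwards [(hmem n).coeFn_toLp] with ω h
      rw [h]
      exact hgC n ω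
    · filter_upwards [hlim, ae_all_iff.2 fun n => (hmem n).coeFn_toLp] with ω h1 h2
      simp only [h2]
      by_cases hω : ω ∈ S
      · simp only [hgdef, Set.indicator_of_mem hω]
        exact (ENNReal.tendsto_toReal ENNReal.zero_ne_top).comp (h1 ((hiff ω).2 hω))
      · simp only [hgdef, Set.indicator_of_notMem hω]
        exact tendsto_const_nhds
  filter_upwards [(hφ₀.tendsto_zero (hbdd.smul (r : ℝ)⁻¹)).eventually_lt_const one_pos] with n hn
  refine le_trans ?_ hrε.le
  rw [supLIntegral_gaugeMeasure_le_iff]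
  intro Z hZ
  have heq : ∫⁻ ω, f n ω ∂densityMeasure P Z =
      ∫⁻ ω, ENNReal.ofReal (g n ω) ∂densityMeasure P Z := by
    refine lintegral_congr_ae ?_
    filter_upwards [(densityMeasure_absolutelyContinuous hφ₀ hne hZ' hZ).ae_le hSQ] with ω hω
    simp only [hgdef, Set.indicator_of_mem hω]
    exact (ENNReal.ofReal_toReal (ne_top_of_le_ne_top ENNReal.coe_ne_top (hfC n ω))).symm
  have hle := pairing_le_of_mem hφ₀ hZ ((r : ℝ)⁻¹ • (hmem n).toLp (g n))
  rw [map_smul, _root_.smul_apply, smul_eq_mul] at hle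
  have hle2 : pairing P ((hmem n).toLp (g n)) Z ≤ (1 + (conjugate P φ₀ Z).toReal) * r := by
    rw [← div_le_iff₀ hr, div_eq_inv_mul]
    linarith
  have hpen : penalty P φ₀ Z = ENNReal.ofReal (conjugate P φ₀ Z).toReal :=
    EReal.toENNReal_of_ne_top (ne_of_lt hZ)
  have hc := toReal_conjugate_nonneg hφ₀ Z
  rw [heq, lintegral_densityMeasure_eq_pairing hφ₀ hZ (hg n) (hg0 n) (hmem n), hpen,
    ← ENNReal.ofReal_coe_nnreal (p := r)]
  refine (ENNReal.ofReal_le_ofReal hle2).trans (le_of_eq ?_)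
  rw [ENNReal.ofReal_mul (by positivity), ENNReal.ofReal_add zero_le_one hc, ENNReal.ofReal_one]

end Gauge

/-! ### Passage from `L^0(P)` to `L^0(Q)` -/

section Projection

variable {P Q : Measure Ω} {φ₀ : Lp ℝ ∞ P → ℝ}

theorem coeFn_proj (h : Q ≪ P) (X : Ω →ₘ[P] ℝ) : proj h X =ᵐ[Q] X :=
  AEEqFun.coeFn_mk _ _

theorem proj_surjective (h : Q ≪ P) : Function.Surjective (proj h) := by
  intro ξ
  refine ⟨AEEqFun.mk ξ ξ.stronglyMeasurable.aestronglyMeasurable, AEEqFun.ext ?_⟩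
  exact (coeFn_proj h _).trans (h.ae_le (AEEqFun.coeFn_mk _ _))

variable [IsFiniteMeasure P]

theorem gaugeNormQ_eq_supLIntegral (hφ₀ : IsLebesgueMonotoneConvex P φ₀) (h : Q ≪ P)
    (hac : ∀ Z, gaugeMeasure P φ₀ Z ≪ Q) (ξ : Ω →ₘ[Q] ℝ) :
    gaugeNormQ h φ₀ ξ = supLIntegral (gaugeMeasure P φ₀) (fun ω => ‖ξ ω‖ₑ) := by
  have key : ∀ X : Ω →ₘ[P] ℝ, proj h X = ξ →
      gaugeNorm P φ₀ X = supLIntegral (gaugeMeasure P φ₀) (fun ω => ‖ξ ω‖ₑ) := by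
    rintro X rfl
    rw [gaugeNorm_eq_supLIntegral hφ₀]
    refine supLIntegral_congr_ae hac ?_
    filter_upwards [coeFn_proj h X] with ω hω
    rw [hω]
  obtain ⟨X, hX⟩ := proj_surjective h ξ
  refine le_antisymm ((iInf₂_le X hX).trans (key X hX).le) (le_iInf₂ fun Y hY => (key Y hY).ge)

theorem spaceMuQ_eq_boundedClosure (hφ₀ : IsLebesgueMonotoneConvex P φ₀) (h : Q ≪ P)
    (hac : ∀ Z, gaugeMeasure P φ₀ Z ≪ Q) :
    spaceMuQ h φ₀ = boundedClosure (gaugeMeasure P φ₀) Q := by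
  have key : ∀ X : Ω →ₘ[P] ℝ,
      X ∈ spaceMu P φ₀ ↔ proj h X ∈ boundedClosure (gaugeMeasure P φ₀) Q := by
    intro X
    rw [mem_spaceMu_iff hφ₀, boundedClosure, Set.mem_ofPred_eq]
    refine forall₂_congr fun ε _ => exists_congr fun K => ?_
    rw [supLIntegral_congr_ae hac (f := fun ω => ‖X ω‖ₑ - K)
      (g := fun ω => ‖proj h X ω‖ₑ - K)]
    filter_upwards [coeFn_proj h X] with ω hω
    rw [hω]
  ext ξ
  obtain ⟨X, rfl⟩ := proj_surjective h ξ
  refine ⟨?_, fun hX => ⟨X, (key X).2 hX, rfl⟩⟩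
  rintro ⟨Y, hY, hYX⟩
  rw [← hYX]
  exact (key Y).1 hY

end Projection

end LebesgueExtension

theorem mainTheorem4 {Ω : Type*} [MeasurableSpace Ω] (P : Measure Ω) [IsProbabilityMeasure P]
    (φ₀ : Lp ℝ ∞ P → ℝ) (hφ₀ : LebesgueExtension.IsLebesgueMonotoneConvex P φ₀)
    (hne : ∃ X, φ₀ X ≠ 0) :
    (∃ Z : Lp ℝ 1 P, LebesgueExtension.IsMaximalSupport P φ₀ Z) ∧
    ∀ Z : Lp ℝ 1 P, LebesgueExtension.IsMaximalSupport P φ₀ Z →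
      IsProbabilityMeasure (LebesgueExtension.measureQ P Z) ∧
      (∀ X : Ω →ₘ[P] ℝ,
        LebesgueExtension.gaugeNormQ (LebesgueExtension.measureQ_absolutelyContinuous P Z) φ₀
            (LebesgueExtension.proj (LebesgueExtension.measureQ_absolutelyContinuous P Z) X) =
          LebesgueExtension.gaugeNorm P φ₀ X) ∧
      LebesgueExtension.IsOrderContinuousBanachLattice (LebesgueExtension.measureQ P Z)
        (LebesgueExtension.spaceMuQ (LebesgueExtension.measureQ_absolutelyContinuous P Z) φ₀)
        (LebesgueExtension.gaugeNormQ (LebesgueExtension.measureQ_absolutelyContinuous P Z) φ₀) := by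
  open LebesgueExtension in
  refine ⟨exists_isMaximalSupport hφ₀, fun Z hZ => ?_⟩
  have hac := gaugeMeasure_absolutelyContinuous hφ₀ hne hZ
  refine ⟨isProbabilityMeasure_measureQ hφ₀ hne hZ, fun X => ?_, ?_⟩
  · rw [gaugeNormQ_eq_supLIntegral hφ₀ _ hac, gaugeNorm_eq_supLIntegral hφ₀]
    refine supLIntegral_congr_ae hac ?_
    filter_upwards [coeFn_proj (measureQ_absolutelyContinuous P Z) X] with ω hω
    rw [hω]
  · rw [spaceMuQ_eq_boundedClosure hφ₀ _ hac,
      funext (gaugeNormQ_eq_supLIntegral hφ₀ (measureQ_absolutelyContinuous P Z) hac)]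
    refine isOrderContinuousBanachLattice_boundedClosure hac (ENNReal.mul_ne_top ?_
      (one_add_penalty_ne_top hZ.1)) (lintegral_measureQ_le hφ₀ hne hZ)
      (hasLebesgueProperty_gaugeMeasure hφ₀ hne hZ)
    exact ENNReal.inv_ne_top.2
      (ENNReal.ofReal_pos.2 (integral_pos_of_isMaximalSupport hφ₀ hne hZ)).ne'
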